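/- **Setting.** Let $d\ge 1$. For $\delta>0$ let $\lambda_\delta$ be $\delta^d$ times the counting measure on $\delta\mathbb Z^d$; let $\lambda_0$ be Lebesgue measure on $\mathbb R^d$ and put $0\mathbb Z^d:=\mathbb R^d$. For a non-negative function $f$ on $\mathbb R^d$ put $S_\delta(f)=\int_{\delta\mathbb Z^d}f(t)\,\lambda_\delta(dt)\in[0,\infty]$. For a non-negative random field $W$ and $\delta,x\ge 0$, the Berman function is $$\mathcal B_W^\delta(x)=\lim_{T\to\infty}\frac1{T^d}\int_0^\infty \mathbb P\Big(\int_{[0,T]^d\cap\delta\mathbb Z^d}\mathbb I(W(t)>s)\,\lambda_\delta(dt)>x\Big)ds,$$ whenever this limit exists. Let $Z(t)$, $t\in\mathbb R^d$, be a non-negative random field with almost surely (generalised) càdlàg sample paths such that $\mathbb E Z(t)=1$ for all $t\in\mathbb R^d$, $\mathbb E\sup_{t\in[0,T]^d}Z(t)<\infty$ for all $T>0$, and $\mathbb P(\sup_{t\in\mathbb R^d}Z(t)>0)=1$. Suppose that the max-stable random field $$X(t)=\max_{i\ge1}\Gamma_i^{-1}Z^{(i)}(t),\quad t\in\mathbb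 R^d,$$ is stationary, where $\Gamma_i=\sum_{k=1}^i\mathcal V_k$ with independent unit exponential random variables $\mathcal V_k$, which are independent of the independent copies $Z^{(i)}$, $i\ge 1$, of $Z$. Let $\Theta$ be a random field with almost surely càdlàg sample paths and law $A\mapsto\mathbb E[Z(0)\,\mathbb I(Z/Z(0)\in A)]$. Write $S_0=S_0(Z)$. **Lemma.** Let $\delta,x\ge0$. (i) If $S_0<\infty$ almost surely, then, with $Q_\delta=\Theta/S_\delta(\Theta)$, the limit $\mathcal B_Z^\delta(x)$ exists and $$\mathcal B_Z^\delta(x)=\int_0^\infty\mathbb P\Big(\int_{\delta\mathbb Z^d}\mathbb I(Q_\delta(t)>s)\,\lambda_\delta(dt)>x\Big)ds<\infty .$$ (ii) If $\mathbb P(S_0<\infty)>0$, let $V$ be $Z$ conditioned on the event $\{S_0<\infty\}$ and normalised to have mean one, i.e. $V$ has the conditional law of $Z/\mathbb E[Z(0)\mid S_0<\infty]$ given $S_0<\infty$. Then the limits $\mathcal B_Z^\delta(x)$ and $\mathcal B_V^\delta(x)$ exist and $$\mathcal B_Z^\delta(x)=\mathbb P(S_0(\Theta)<\infty)\,\mathcal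 B_V^\delta(x)<\infty .$$ -/

import Mathlib

open MeasureTheory ProbabilityTheory Filter Topology Set
open scoped NNReal ENNReal

/-- Functions `ℝᵈ → [0, ∞)`, with the σ-field generated by the coordinate projections
(the product σ-field). On càdlàg functions it coincides with the σ-field generated by the
projections at the points of any countable dense set. -/
abbrev FieldPath (d : ℕ) : Type := (Fin d → ℝ) → ℝ≥0

/-- The quadrant at `t` with signs `ρ`: those `s` with `t i ≤ s i` where `ρ i` is true and
`s i < t i` where `ρ i` is false. -/
def quadrant {d : ℕ} (t : Fin d → ℝ) (ρ : Fin d → Bool) : Set (Fin d → ℝ) :=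
  {s | ∀ i, if ρ i = true then t i ≤ s i else s i < t i}

/-- (Generalised) càdlàg functions on `ℝᵈ`: at every point the limit from each of the `2 ^ d`
quadrants exists, and the function is continuous from the upper closed quadrant. -/
def IsCadlag {d : ℕ} (f : FieldPath d) : Prop :=
  ∀ t, (∀ ρ, ∃ l : ℝ≥0, Tendsto f (𝓝[quadrant t ρ] t) (𝓝 l)) ∧ ContinuousWithinAt f (Ici t) t

/-- The measure `λ_δ`: Lebesgue measure on `ℝᵈ` if `δ = 0`, and `δ ^ d` times the counting
measure on the lattice `δ ℤᵈ` if `δ > 0`. -/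
noncomputable def lam (d : ℕ) (δ : ℝ≥0) : Measure (Fin d → ℝ) :=
  if δ = 0 then volume
  else ((δ : ℝ≥0∞) ^ d) •
    Measure.sum (fun k : Fin d → ℤ => Measure.dirac (fun i => (δ : ℝ) * (k i : ℝ)))

/-- `S_δ(f) = ∫_{δ ℤᵈ} f(t) λ_δ(dt)`, with values in `[0, ∞]`. -/
noncomputable def totalMass {d : ℕ} (δ : ℝ≥0) (f : FieldPath d) : ℝ≥0∞ :=
  ∫⁻ t, (f t : ℝ≥0∞) ∂(lam d δ)

/-- The sojourn functional `∫_{K ∩ δ ℤᵈ} 𝟙(f(t) > s) λ_δ(dt)`. -/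
noncomputable def sojourn {d : ℕ} (δ : ℝ≥0) (K : Set (Fin d → ℝ)) (s : ℝ) (f : FieldPath d) : ℝ≥0∞ :=
  lam d δ {t | t ∈ K ∧ s < (f t : ℝ)}

/-- `∫_0^∞ P (∫_{K ∩ δ ℤᵈ} 𝟙(W(t) > s) λ_δ(dt) > x) ds`. -/
noncomputable def bermanOn {d : ℕ} {Ω : Type*} [MeasurableSpace Ω] (P : Measure Ω)
    (W : Ω → FieldPath d) (δ : ℝ≥0) (K : Set (Fin d → ℝ)) (x : ℝ≥0) : ℝ≥0∞ :=
  ∫⁻ s in Ioi (0 : ℝ), P {ω | (x : ℝ≥0∞) < sojourn δ K s (W ω)}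

/-- The normalised quantity `T ^ (-d) * 𝓑_W^δ([0, T]ᵈ ∩ δ ℤᵈ, x)`. -/
noncomputable def bermanRatio {d : ℕ} {Ω : Type*} [MeasurableSpace Ω] (P : Measure Ω)
    (W : Ω → FieldPath d) (δ x : ℝ≥0) (T : ℝ) : ℝ≥0∞ :=
  bermanOn P W δ (Icc 0 (fun _ => T)) x / ENNReal.ofReal (T ^ d)

/-- The Berman function `𝓑_W^δ(x)`, the limit of the normalised quantity as `T → ∞`
(meaningful when that limit exists). -/
noncomputable def berman {d : ℕ} {Ω : Type*} [MeasurableSpace Ω] (P : Measure Ω)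
    (W : Ω → FieldPath d) (δ x : ℝ≥0) : ℝ≥0∞ :=
  limUnder atTop (bermanRatio P W δ x)

/-- The assumptions on the field `Z` itself: it is a random field with almost surely càdlàg
paths, mean one, locally integrable suprema, and it almost surely does not vanish identically. -/
structure IsSpectralField {d : ℕ} {Ω : Type*} [MeasurableSpace Ω] (P : Measure Ω)
    (Z : Ω → FieldPath d) : Prop where
  measurable : Measurable Z
  cadlag : ∀ᵐ ω ∂P, IsCadlag (Z ω)
  mean_one : ∀ t, ∫⁻ ω, (Z ω t : ℝ≥0∞) ∂P = 1
  sup_integrable : ∀ T : ℝ, 0 < T →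
    ∫⁻ ω, (⨆ t ∈ Icc (0 : Fin d → ℝ) (fun _ => T), (Z ω t : ℝ≥0∞)) ∂P < ∞
  nonzero : ∀ᵐ ω ∂P, ∃ t, 0 < Z ω t

/-- The random input of the de Haan representation with spectral field `Z`: independent unit
exponential variables `E k`, and, independent of them, independent copies `Zc i` of `Z`. -/
structure IsDeHaanInput {d : ℕ} {Ω Ω₁ : Type*} [MeasurableSpace Ω] [MeasurableSpace Ω₁]
    (P : Measure Ω) (Z : Ω → FieldPath d) (P₁ : Measure Ω₁)
    (E : ℕ → Ω₁ → ℝ) (Zc : ℕ → Ω₁ → FieldPath d) : Prop where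
  measurable_exp : ∀ k, Measurable (E k)
  law_exp : ∀ k, P₁.map (E k) = expMeasure 1
  indep_exp : iIndepFun E P₁
  measurable_copy : ∀ i, Measurable (Zc i)
  law_copy : ∀ i, P₁.map (Zc i) = P.map Z
  indep_copy : iIndepFun Zc P₁
  indep : IndepFun (fun ω k => E k ω) (fun ω i => Zc i ω) P₁

/-- The max-stable field `X(t) = max_i Γ_i⁻¹ Z⁽ⁱ⁾(t)`, where `Γ_i` is the sum of the exponential
variables up to (and including) index `i`; indices start at `0`. -/
noncomputable def deHaanField {d : ℕ} {Ω₁ : Type*} (E : ℕ → Ω₁ → ℝ) (Zc : ℕ → Ω₁ → FieldPath d) :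
    Ω₁ → (Fin d → ℝ) → ℝ≥0∞ :=
  fun ω t => ⨆ i : ℕ, (Zc i ω t : ℝ≥0∞) / ENNReal.ofReal (∑ k ∈ Finset.range (i + 1), E k ω)

/-- Stationarity: the laws of `X(· + h)` and `X` (equivalently, their finite-dimensional
distributions) agree for every shift `h`. -/
def IsStationaryField {d : ℕ} {Ω₁ : Type*} [MeasurableSpace Ω₁] (P₁ : Measure Ω₁)
    (X : Ω₁ → (Fin d → ℝ) → ℝ≥0∞) : Prop :=
  ∀ h : Fin d → ℝ, P₁.map (fun ω t => X ω (t + h)) = P₁.map X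

/-- `Θ` is a random field with almost surely càdlàg paths whose law is
`A ↦ E[Z(0) 𝟙(Z / Z(0) ∈ A)]`. -/
structure IsTiltedField {d : ℕ} {Ω Ω₂ : Type*} [MeasurableSpace Ω] [MeasurableSpace Ω₂]
    (P : Measure Ω) (Z : Ω → FieldPath d) (P₂ : Measure Ω₂) (Θ : Ω₂ → FieldPath d) : Prop where
  measurable : Measurable Θ
  cadlag : ∀ᵐ ω ∂P₂, IsCadlag (Θ ω)
  law : ∀ A : Set (FieldPath d), MeasurableSet A →
    P₂ {ω | Θ ω ∈ A} = ∫⁻ ω in {ω | (fun t => Z ω t / Z ω 0) ∈ A}, (Z ω 0 : ℝ≥0∞) ∂P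

/-- The field `Q_δ = Θ / S_δ(Θ)`. -/
noncomputable def normalizedField {d : ℕ} {Ω₂ : Type*} (δ : ℝ≥0) (Θ : Ω₂ → FieldPath d) :
    Ω₂ → FieldPath d :=
  fun ω t => Θ ω t / (totalMass δ (Θ ω)).toNNReal

/-- The law `P(· | S_0(Z) < ∞)`. -/
noncomputable def finiteMassCond {d : ℕ} {Ω : Type*} [MeasurableSpace Ω] (P : Measure Ω)
    (Z : Ω → FieldPath d) : Measure Ω :=
  ProbabilityTheory.cond P {ω | totalMass 0 (Z ω) < ∞}

/-- The field `V`, to be considered under the conditional law `P(· | S_0(Z) < ∞)`: the field `Z`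
rescaled by the constant `E[Z(0) | S_0(Z) < ∞]`, so that it has mean one under that law. -/
noncomputable def conditionedField {d : ℕ} {Ω : Type*} [MeasurableSpace Ω] (P : Measure Ω)
    (Z : Ω → FieldPath d) : Ω → FieldPath d :=
  fun ω t => Z ω t / (∫⁻ ω', (Z ω' 0 : ℝ≥0∞) ∂(finiteMassCond P Z)).toNNReal

/-!
Since `P(X(t₁) ≤ u₁, …, X(tₙ) ≤ uₙ) = exp (-E[max_k Z(t_k) / u_k])`, stationarity of `X` says that
the expectations `E[max_k c_k Z(t_k)]` are shift invariant. These determine the law of `Z(· + τ)`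
normalised by its value at a point, so `E[F(Z(· + τ))] = E[F(Z)]` for every functional `F` that is
homogeneous of degree one. The integral defining the Berman function is, by Fubini's theorem, the
mean of such a functional, the excess.

Divide `ℝᵈ` into cubes and split the expected excess over `[0, T]ᵈ` according to the first cube (in
lexicographic order) of `[0, T]ᵈ` in which `Z` has its largest supremum. By shift invariance the
maximal cube can be moved to the origin; away from the boundary the term then converges to the
expected excess over all of `ℝᵈ` on the event that the cube at the origin is the first maximal one.

Shift invariance also allows mass transport between the cubes. Transporting the suprema shows that
a path with a first maximal cube almost surely has summable suprema, so only paths with `S_0 < ∞`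
contribute to the limit; this gives (ii). Transporting the mass `S_δ` from the cubes to the maximal
cube turns the limit into the expected excess of `Θ / S_δ(Θ)`; this gives (i).
-/

/-! ### The maximum of a de Haan series -/

section Exponential

variable {r : ℝ}

lemma expMeasure_Iic (hr : 0 < r) {u : ℝ} (hu : 0 ≤ u) :
    expMeasure r (Iic u) = ENNReal.ofReal (1 - Real.exp (-(r * u))) := by
  have := isProbabilityMeasure_expMeasure hr
  rw [← ofReal_cdf, cdf_expMeasure_eq hr, if_pos hu]

lemma expMeasure_Ico (hr : 0 < r) {u : ℝ} (hu : 0 ≤ u) :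
    expMeasure r (Ico 0 u) = ENNReal.ofReal (1 - Real.exp (-(r * u))) := by
  have : NullSingletonClass (expMeasure r) := by
    rw [expMeasure, gammaMeasure]
    infer_instance
  have hneg : expMeasure r (Iio 0) = 0 := by
    rw [expMeasure, gammaMeasure, withDensity_apply _ measurableSet_Iio]
    exact lintegral_exponentialPDF_of_nonpos le_rfl
  have hdiff : Ico 0 u = Iio u \ Iio 0 := by
    ext v
    simp [and_comm]
  rw [hdiff, measure_sdiff_null hneg, measure_congr Iio_ae_eq_Iic, expMeasure_Iic hr hu]

lemma exponentialPDF_mul_indicator_add (hr : 0 ≤ r) (u v : ℝ) :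
    exponentialPDF r v * ((Iic u).indicator 1 v + ENNReal.ofReal (r * (u - v))) =
      (Icc 0 u).indicator
        (fun v => ENNReal.ofReal (r * Real.exp (-(r * v)) * (1 + r * (u - v)))) v := by
  rcases lt_or_ge v 0 with hv | hv
  · simp [exponentialPDF_of_neg hv, hv]
  rcases lt_or_ge u v with huv | huv
  · have : r * (u - v) ≤ 0 := mul_nonpos_of_nonneg_of_nonpos hr (by linarith)
    simp [huv, this]
  have : 0 ≤ r * (u - v) := mul_nonneg hr (by linarith)
  rw [indicator_of_mem (show v ∈ Icc 0 u from ⟨hv, huv⟩),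
    indicator_of_mem (show v ∈ Iic u from huv), exponentialPDF_of_nonneg hv, Pi.one_apply,
    ← ENNReal.ofReal_one, ← ENNReal.ofReal_add zero_le_one this,
    ← ENNReal.ofReal_mul (by positivity)]

lemma integral_mul_exp_neg_mul_one_add (r u : ℝ) :
    ∫ v in 0..u, r * Real.exp (-(r * v)) * (1 + r * (u - v)) = r * u := by
  have hderiv (v : ℝ) : HasDerivAt (fun v => -(Real.exp (-(r * v)) * (r * (u - v))))
      (r * Real.exp (-(r * v)) * (1 + r * (u - v))) v := by
    have hexp := ((hasDerivAt_id v).const_mul r).neg.exp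
    have hlin := ((hasDerivAt_id v).const_sub u).const_mul r
    refine (hexp.mul hlin).neg.congr_deriv ?_
    simp only [id, Pi.neg_apply]
    ring
  have hcont : Continuous fun v : ℝ => r * Real.exp (-(r * v)) * (1 + r * (u - v)) := by fun_prop
  rw [intervalIntegral.integral_eq_sub_of_hasDerivAt (fun v _ => hderiv v)
    (hcont.intervalIntegrable _ _)]
  simp

/- The renewal equation `F u + ∫ m (u - v) dF(v) = m u` of the renewal measure `m u = r u` of the
Poisson process. -/
lemma expMeasure_Iic_add_lintegral (hr : 0 ≤ r) (u : ℝ) :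
    expMeasure r (Iic u) + ∫⁻ v, ENNReal.ofReal (r * (u - v)) ∂(expMeasure r) =
      ENNReal.ofReal (r * u) := by
  have hmeas : Measurable fun v => (Iic u).indicator (1 : ℝ → ℝ≥0∞) v +
      ENNReal.ofReal (r * (u - v)) :=
    (measurable_one.indicator measurableSet_Iic).add (by fun_prop)
  rw [← lintegral_indicator_one measurableSet_Iic, ← lintegral_add_right _ (by fun_prop),
    expMeasure, gammaMeasure, lintegral_withDensity_eq_lintegral_mul _ (f := gammaPDF 1 r)
      (measurable_gammaPDFReal 1 r).ennreal_ofReal hmeas]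
  refine (lintegral_congr fun v => exponentialPDF_mul_indicator_add hr u v).trans ?_
  rw [lintegral_indicator measurableSet_Icc]
  rcases lt_or_ge u 0 with hu | hu
  · simp [hu, mul_nonpos_of_nonneg_of_nonpos hr hu.le]
  have hcont : Continuous fun v : ℝ => r * Real.exp (-(r * v)) * (1 + r * (u - v)) := by fun_prop
  have hnonneg : ∀ v ∈ Icc 0 u, 0 ≤ r * Real.exp (-(r * v)) * (1 + r * (u - v)) := fun v hv =>
    mul_nonneg (mul_nonneg hr (Real.exp_pos _).le)
      (add_nonneg zero_le_one (mul_nonneg hr (sub_nonneg.2 hv.2)))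
  rw [← ofReal_integral_eq_lintegral_ofReal hcont.integrableOn_Icc
    (ae_restrict_of_forall_mem measurableSet_Icc hnonneg), integral_Icc_eq_integral_Ioc,
    ← intervalIntegral.integral_of_le hu, integral_mul_exp_neg_mul_one_add]

end Exponential

section Arrival

variable {Ω : Type*} [MeasurableSpace Ω] {P : Measure Ω} [IsFiniteMeasure P]

lemma measure_prodMk_mem_eq_lintegral {α β : Type*} [MeasurableSpace α] [MeasurableSpace β]
    {X : Ω → α} {Y : Ω → β} (hX : Measurable X) (hY : Measurable Y) (h : IndepFun X Y P)
    {A : Set (α × β)} (hA : MeasurableSet A) :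
    P {ω | (X ω, Y ω) ∈ A} = ∫⁻ a, P {ω | (a, Y ω) ∈ A} ∂(P.map X) := by
  have hlaw := (indepFun_iff_map_prod_eq_prod_map_map hX.aemeasurable hY.aemeasurable).1 h
  calc P ((fun ω => (X ω, Y ω)) ⁻¹' A)
    _ = ∫⁻ a, P.map Y (Prod.mk a ⁻¹' A) ∂(P.map X) := by
        rw [← Measure.map_apply (hX.prodMk hY) hA, hlaw, Measure.prod_apply hA]
    _ = _ := lintegral_congr fun a => Measure.map_apply hY (measurable_prodMk_left hA)

/-- The arrival times `Γ_i = E_0 + ⋯ + E_i` of the point process with interarrival times `E`. -/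
def arrivalTime {Ω : Type*} (E : ℕ → Ω → ℝ) (i : ℕ) (ω : Ω) : ℝ :=
  ∑ k ∈ Finset.range (i + 1), E k ω

lemma arrivalTime_zero {Ω : Type*} (E : ℕ → Ω → ℝ) : arrivalTime E 0 = E 0 := by
  ext ω
  simp [arrivalTime]

lemma arrivalTime_succ {Ω : Type*} (E : ℕ → Ω → ℝ) (i : ℕ) (ω : Ω) :
    arrivalTime E (i + 1) ω = E (i + 1) ω + arrivalTime E i ω := by
  rw [arrivalTime, Finset.sum_range_succ, add_comm, arrivalTime]

lemma measurable_arrivalTime {E : ℕ → Ω → ℝ} (hE : ∀ k, Measurable (E k)) (i : ℕ) :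
    Measurable (arrivalTime E i) :=
  Finset.measurable_sum _ fun k _ => hE k

lemma sum_measure_arrivalTime_le {r : ℝ} (hr : 0 ≤ r) {E : ℕ → Ω → ℝ}
    (hE : ∀ k, Measurable (E k)) (hlaw : ∀ k, P.map (E k) = expMeasure r) (hindep : iIndepFun E P)
    (N : ℕ) (u : ℝ) :
    ∑ i ∈ Finset.range N, P {ω | arrivalTime E i ω ≤ u} ≤ ENNReal.ofReal (r * u) := by
  induction N generalizing u with
  | zero => simp
  | succ N ih =>
    have hfirst : P {ω | arrivalTime E 0 ω ≤ u} = expMeasure r (Iic u) := by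
      rw [← hlaw 0, Measure.map_apply (hE 0) measurableSet_Iic, arrivalTime_zero]
      rfl
    have hlater (i : ℕ) : P {ω | arrivalTime E (i + 1) ω ≤ u} =
        ∫⁻ v, P {ω | arrivalTime E i ω ≤ u - v} ∂(expMeasure r) := by
      have hind : IndepFun (E (i + 1)) (arrivalTime E i) P := by
        have := hindep.indepFun_finsetSum_of_notMem hE (s := Finset.range (i + 1)) (i := i + 1)
          (by simp)
        convert this.symm using 1
        ext ω
        simp [arrivalTime]
      have hA : MeasurableSet {p : ℝ × ℝ | p.2 ≤ u - p.1} :=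
        measurableSet_le (by fun_prop) (by fun_prop)
      simp only [arrivalTime_succ, ← le_sub_iff_add_le']
      rw [← hlaw (i + 1)]
      exact measure_prodMk_mem_eq_lintegral (hE _) (measurable_arrivalTime hE i) hind hA
    have hmeas (i : ℕ) : Measurable fun v : ℝ => P {ω | arrivalTime E i ω ≤ u - v} :=
      Antitone.measurable fun a b hab => measure_mono fun ω hω =>
        le_trans (show _ ≤ u - b from hω) (by linarith)
    calc ∑ i ∈ Finset.range (N + 1), P {ω | arrivalTime E i ω ≤ u}
      _ = expMeasure r (Iic u) +
          ∫⁻ v, ∑ i ∈ Finset.range N, P {ω | arrivalTime E i ω ≤ u - v} ∂(expMeasure r) := by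
        rw [Finset.sum_range_succ', hfirst, Finset.sum_congr rfl fun i _ => hlater i,
          ← lintegral_finsetSum _ fun i _ => hmeas i, add_comm]
      _ ≤ expMeasure r (Iic u) + ∫⁻ v, ENNReal.ofReal (r * (u - v)) ∂(expMeasure r) := by
        gcongr with v
        exact ih (u - v)
      _ = ENNReal.ofReal (r * u) := expMeasure_Iic_add_lintegral hr u

variable {E : ℕ → Ω → ℝ} {W : ℕ → Ω → ℝ≥0} {ν : Measure ℝ≥0} {y : ℝ≥0}

lemma lintegral_one_sub_exp_le_measure_lt_iSup_div (hE : Measurable (E 0))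
    (hlaw : P.map (E 0) = expMeasure 1) (hW : Measurable (W 0)) (hν : P.map (W 0) = ν)
    (hindep : IndepFun (E 0) (W 0) P) (hy : 0 < y) :
    ∫⁻ w : ℝ≥0, ENNReal.ofReal (1 - Real.exp (-((w : ℝ) / y))) ∂ν ≤
      P {ω | (y : ℝ≥0∞) < ⨆ i, (W i ω : ℝ≥0∞) / ENNReal.ofReal (arrivalTime E i ω)} := by
  have hA : MeasurableSet {p : ℝ≥0 × ℝ | p.2 ∈ Ico (0 : ℝ) (p.1 / y)} :=
    (measurableSet_le measurable_const measurable_snd).inter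
      (measurableSet_lt measurable_snd (by fun_prop))
  calc ∫⁻ w : ℝ≥0, ENNReal.ofReal (1 - Real.exp (-((w : ℝ) / y))) ∂ν
    _ = ∫⁻ w, P {ω | (w, E 0 ω) ∈ {p : ℝ≥0 × ℝ | p.2 ∈ Ico (0 : ℝ) (p.1 / y)}} ∂ν := by
      refine lintegral_congr fun w => ?_
      rw [← one_mul ((w : ℝ) / y), ← expMeasure_Ico one_pos (by positivity), ← hlaw,
        Measure.map_apply hE measurableSet_Ico]
      rfl
    _ = P {ω | E 0 ω ∈ Ico (0 : ℝ) (W 0 ω / y)} := by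
      rw [← hν, ← measure_prodMk_mem_eq_lintegral hW hE hindep.symm hA]
      rfl
    _ ≤ _ := by
      refine measure_mono fun ω ⟨hnonneg, hlt⟩ => ?_
      refine lt_of_lt_of_le (b := (W 0 ω : ℝ≥0∞) / ENNReal.ofReal (arrivalTime E 0 ω)) ?_
        (le_iSup (fun i => (W i ω : ℝ≥0∞) / ENNReal.ofReal (arrivalTime E i ω)) 0)
      rw [arrivalTime_zero, ENNReal.lt_div_iff_mul_lt (by simp) (by simp), mul_comm,
        ← ENNReal.ofReal_coe_nnreal, ← ENNReal.ofReal_mul hnonneg, ← ENNReal.ofReal_coe_nnreal]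
      rw [lt_div_iff₀ (by exact_mod_cast hy)] at hlt
      exact ENNReal.ofReal_lt_ofReal_iff_of_nonneg (by positivity) |>.2 hlt

lemma mul_measure_lt_iSup_div_le (hE : ∀ k, Measurable (E k))
    (hlaw : ∀ k, P.map (E k) = expMeasure 1) (hindepE : iIndepFun E P)
    (hW : ∀ i, Measurable (W i)) (hν : ∀ i, P.map (W i) = ν)
    (hindep : ∀ i, IndepFun (arrivalTime E i) (W i) P) (hy : 0 < y) :
    y * P {ω | (y : ℝ≥0∞) < ⨆ i, (W i ω : ℝ≥0∞) / ENNReal.ofReal (arrivalTime E i ω)} ≤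
      ∫⁻ w : ℝ≥0, w ∂ν := by
  have hA : MeasurableSet {p : ℝ≥0 × ℝ | p.2 ≤ p.1 / y} :=
    measurableSet_le measurable_snd (by fun_prop)
  have hmeas (i : ℕ) : Measurable fun w : ℝ≥0 => P {ω | arrivalTime E i ω ≤ w / y} :=
    Monotone.measurable fun a b hab => measure_mono fun ω hω =>
      le_trans (show _ ≤ (a : ℝ) / y from hω) (by gcongr)
  have harrival {ω : Ω} {i : ℕ}
      (hlt : (y : ℝ≥0∞) < (W i ω : ℝ≥0∞) / ENNReal.ofReal (arrivalTime E i ω)) :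
      arrivalTime E i ω ≤ W i ω / y := by
    rw [le_div_iff₀ (by exact_mod_cast hy), mul_comm]
    have := ENNReal.mul_lt_of_lt_div hlt
    rw [← ENNReal.ofReal_coe_nnreal, ← ENNReal.ofReal_mul y.coe_nonneg,
      ← ENNReal.ofReal_coe_nnreal] at this
    exact (ENNReal.ofReal_lt_ofReal_iff'.1 this).1.le
  calc y * P {ω | (y : ℝ≥0∞) < ⨆ i, (W i ω : ℝ≥0∞) / ENNReal.ofReal (arrivalTime E i ω)}
    _ ≤ y * ∑' i, P {ω | arrivalTime E i ω ≤ W i ω / y} := by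
      gcongr
      refine (measure_mono fun ω hω => ?_).trans (measure_iUnion_le _)
      rw [mem_ofPred_eq, lt_iSup_iff] at hω
      obtain ⟨i, hi⟩ := hω
      exact mem_iUnion.2 ⟨i, harrival hi⟩
    _ = y * ∫⁻ w : ℝ≥0, ∑' i, P {ω | arrivalTime E i ω ≤ w / y} ∂ν := by
      rw [lintegral_tsum fun i => (hmeas i).aemeasurable]
      congr 1
      refine tsum_congr fun i => ?_
      rw [← hν i]
      exact measure_prodMk_mem_eq_lintegral (hW i) (measurable_arrivalTime hE i) (hindep i).symm hA
    _ ≤ y * ∫⁻ w : ℝ≥0, ENNReal.ofReal (1 * (w / y)) ∂ν := by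
      gcongr with w
      rw [ENNReal.tsum_eq_iSup_nat]
      exact iSup_le fun N => sum_measure_arrivalTime_le zero_le_one hE hlaw hindepE N _
    _ = ∫⁻ w : ℝ≥0, w ∂ν := by
      rw [← lintegral_const_mul' _ _ ENNReal.coe_ne_top]
      refine lintegral_congr fun w => ?_
      rw [one_mul, ← ENNReal.ofReal_coe_nnreal, ← ENNReal.ofReal_mul y.coe_nonneg,
        mul_div_cancel₀ _ (by exact_mod_cast hy.ne'), ENNReal.ofReal_coe_nnreal]

lemma tendsto_natCast_mul_one_sub_exp_neg_div (u : ℝ≥0) :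
    Tendsto (fun n : ℕ => (n : ℝ≥0∞) * ENNReal.ofReal (1 - Real.exp (-((u : ℝ) / n)))) atTop
      (𝓝 u) := by
  have hderiv : HasDerivAt (fun z : ℝ => 1 - Real.exp (-((u : ℝ) * z))) u 0 :=
    (((hasDerivAt_id (0 : ℝ)).const_mul (u : ℝ)).neg.exp.const_sub 1).congr_deriv (by simp)
  have hreal : Tendsto (fun n : ℕ => (n : ℝ) * (1 - Real.exp (-((u : ℝ) / n)))) atTop (𝓝 u) :=
    (hderiv.tendsto_slope_zero_right.comp (tendsto_inv_atTop_nhdsGT_zero.comp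
      tendsto_natCast_atTop_atTop)).congr fun n => by simp [div_eq_mul_inv]
  have hlim := ENNReal.tendsto_ofReal hreal
  rw [ENNReal.ofReal_coe_nnreal] at hlim
  refine hlim.congr fun n => ?_
  rw [ENNReal.ofReal_mul n.cast_nonneg, ENNReal.ofReal_natCast]

/- The lower bound keeps only the first point of the series, the upper bound is a union bound over
all points; they agree to first order. -/
lemma tendsto_mul_measure_lt_iSup_div (hE : ∀ k, Measurable (E k))
    (hlaw : ∀ k, P.map (E k) = expMeasure 1) (hindepE : iIndepFun E P)
    (hW : ∀ i, Measurable (W i)) (hν : ∀ i, P.map (W i) = ν)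
    (hindep : ∀ i, IndepFun (arrivalTime E i) (W i) P) :
    Tendsto (fun n : ℕ => (n : ℝ≥0∞) *
        P {ω | (n : ℝ≥0∞) < ⨆ i, (W i ω : ℝ≥0∞) / ENNReal.ofReal (arrivalTime E i ω)})
      atTop (𝓝 (∫⁻ w : ℝ≥0, w ∂ν)) := by
  refine tendsto_of_le_liminf_of_limsup_le ?_ ?_
  · calc ∫⁻ w : ℝ≥0, w ∂ν
      _ = ∫⁻ w : ℝ≥0, liminf (fun n : ℕ =>
          (n : ℝ≥0∞) * ENNReal.ofReal (1 - Real.exp (-((w : ℝ) / n)))) atTop ∂ν :=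
        lintegral_congr fun w => (tendsto_natCast_mul_one_sub_exp_neg_div w).liminf_eq.symm
      _ ≤ liminf (fun n : ℕ => ∫⁻ w : ℝ≥0,
          (n : ℝ≥0∞) * ENNReal.ofReal (1 - Real.exp (-((w : ℝ) / n))) ∂ν) atTop :=
        lintegral_liminf_le fun n => by fun_prop
      _ ≤ _ := by
        refine liminf_le_liminf ?_
        filter_upwards [eventually_gt_atTop 0] with n hn
        rw [lintegral_const_mul' _ _ (ENNReal.natCast_ne_top n)]
        gcongr
        simpa using lintegral_one_sub_exp_le_measure_lt_iSup_div (y := n) (hE 0) (hlaw 0) (hW 0)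
          (hν 0) (by simpa only [arrivalTime_zero] using hindep 0) (by exact_mod_cast hn)
  · refine limsup_le_of_le (by isBoundedDefault) ?_
    filter_upwards [eventually_gt_atTop 0] with n hn
    simpa using mul_measure_lt_iSup_div_le (y := n) hE hlaw hindepE hW hν hindep
      (by exact_mod_cast hn)

end Arrival

section WeightedMax

variable {ι R : Type*} [SemilatticeSup R] [OrderBot R] [SMul ℝ≥0 R]

/-- The weighted maximum `max_{(t, c) ∈ s} c • f t`, for `ℝ≥0`- as well as `ℝ≥0∞`-valued `f`. -/
def weightedMax (s : Finset (ι × ℝ≥0)) (f : ι → R) : R :=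
  s.sup fun p => p.2 • f p.1

@[fun_prop]
lemma measurable_weightedMax [MeasurableSpace R] [MeasurableSup₂ R] [MeasurableConstSMul ℝ≥0 R]
    (s : Finset (ι × ℝ≥0)) : Measurable (weightedMax s : (ι → R) → R) := by
  classical
  unfold weightedMax
  induction s using Finset.induction_on with
  | empty => simp only [Finset.sup_empty, measurable_const]
  | insert p s _ ih =>
    simp only [Finset.sup_insert]
    exact ((measurable_pi_apply p.1).const_smul p.2).sup ih

lemma weightedMax_comp {κ : Type*} [DecidableEq ι] (s : Finset (κ × ℝ≥0)) (e : κ → ι) (f : ι → R) :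
    weightedMax s (fun t => f (e t)) = weightedMax (s.image (Prod.map e id)) f := by
  simp [weightedMax, Finset.sup_image, Function.comp_def]

lemma coe_weightedMax (s : Finset (ι × ℝ≥0)) (f : ι → ℝ≥0) :
    ((weightedMax s f : ℝ≥0) : ℝ≥0∞) = weightedMax s fun t => (f t : ℝ≥0∞) := by
  rw [weightedMax, Finset.apply_sup_eq_sup_comp (fun c : ℝ≥0 => (c : ℝ≥0∞))
    (fun a b => ENNReal.coe_max a b) rfl]
  simp [weightedMax, Function.comp_def, ENNReal.smul_def]

lemma weightedMax_mul (s : Finset (ι × ℝ≥0)) (c : ℝ≥0) (f : ι → ℝ≥0) :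
    weightedMax s (fun t => c * f t) = c * weightedMax s f := by
  simp only [weightedMax, NNReal.mul_finset_sup, smul_eq_mul]
  exact Finset.sup_congr rfl fun p _ => by ring

end WeightedMax

section DeHaan

variable {d : ℕ} {Ω Ω₁ : Type*} {E : ℕ → Ω₁ → ℝ} {Zc : ℕ → Ω₁ → FieldPath d}

lemma weightedMax_deHaanField (s : Finset ((Fin d → ℝ) × ℝ≥0)) (E : ℕ → Ω₁ → ℝ)
    (Zc : ℕ → Ω₁ → FieldPath d) (ω : Ω₁) :
    weightedMax s (deHaanField E Zc ω) =
      ⨆ i, ((weightedMax s (Zc i ω) : ℝ≥0) : ℝ≥0∞) / ENNReal.ofReal (arrivalTime E i ω) := by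
  simp only [coe_weightedMax]
  simp only [weightedMax, deHaanField, arrivalTime, Finset.sup_eq_iSup, ENNReal.smul_def,
    smul_eq_mul, ENNReal.mul_iSup, div_eq_mul_inv, ENNReal.iSup_mul, ← mul_assoc]
  rw [iSup_congr fun p => iSup_comm, iSup_comm]

variable [MeasurableSpace Ω] [MeasurableSpace Ω₁] {P : Measure Ω} {P₁ : Measure Ω₁}
  {Z : Ω → FieldPath d}

lemma IsDeHaanInput.measurable_deHaanField (hX : IsDeHaanInput P Z P₁ E Zc) :
    Measurable (deHaanField E Zc) :=
  measurable_pi_lambda _ fun t => Measurable.iSup fun i =>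
    ((measurable_pi_apply t).comp (hX.measurable_copy i)).coe_nnreal_ennreal.div
      (measurable_arrivalTime hX.measurable_exp i).ennreal_ofReal

variable [IsFiniteMeasure P₁]

lemma IsDeHaanInput.tendsto_mul_measure_lt_weightedMax (hX : IsDeHaanInput P Z P₁ E Zc)
    (hZ : Measurable Z) (s : Finset ((Fin d → ℝ) × ℝ≥0)) :
    Tendsto (fun n : ℕ => (n : ℝ≥0∞) * P₁ {ω | (n : ℝ≥0∞) < weightedMax s (deHaanField E Zc ω)})
      atTop (𝓝 (∫⁻ ω, (weightedMax s (Z ω) : ℝ≥0) ∂P)) := by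
  have hmax : Measurable (weightedMax s : FieldPath d → ℝ≥0) := measurable_weightedMax s
  have hindep (i : ℕ) : IndepFun (arrivalTime E i) (fun ω => weightedMax s (Zc i ω)) P₁ :=
    hX.indep.comp (φ := fun e : ℕ → ℝ => ∑ k ∈ Finset.range (i + 1), e k)
      (ψ := fun z : ℕ → FieldPath d => weightedMax s (z i)) (by fun_prop)
      (hmax.comp (measurable_pi_apply i))
  have hlaw (i : ℕ) : P₁.map (fun ω => weightedMax s (Zc i ω)) =
      P.map fun ω => weightedMax s (Z ω) := by
    rw [← Function.comp_def, ← Measure.map_map hmax (hX.measurable_copy i), hX.law_copy,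
      Measure.map_map hmax hZ, Function.comp_def]
  have hlim := tendsto_mul_measure_lt_iSup_div hX.measurable_exp hX.law_exp hX.indep_exp
    (fun i => hmax.comp (hX.measurable_copy i)) hlaw hindep
  rw [lintegral_map (f := fun w : ℝ≥0 => (w : ℝ≥0∞))
    (g := fun ω => weightedMax s (Z ω)) measurable_coe_nnreal_ennreal (hmax.comp hZ)] at hlim
  simpa only [weightedMax_deHaanField, Function.comp_apply] using hlim

theorem IsDeHaanInput.lintegral_weightedMax_shift (hX : IsDeHaanInput P Z P₁ E Zc)
    (hZ : Measurable Z) (hstat : IsStationaryField P₁ (deHaanField E Zc))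
    (s : Finset ((Fin d → ℝ) × ℝ≥0)) (h : Fin d → ℝ) :
    ∫⁻ ω, (weightedMax s (fun t => Z ω (t + h)) : ℝ≥0) ∂P =
      ∫⁻ ω, (weightedMax s (Z ω) : ℝ≥0) ∂P := by
  classical
  simp only [weightedMax_comp s (· + h)]
  refine tendsto_nhds_unique (hX.tendsto_mul_measure_lt_weightedMax hZ _) ?_
  refine (hX.tendsto_mul_measure_lt_weightedMax hZ s).congr fun n => ?_
  have hset : MeasurableSet {f : (Fin d → ℝ) → ℝ≥0∞ | (n : ℝ≥0∞) < weightedMax s f} :=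
    measurableSet_lt measurable_const (measurable_weightedMax s)
  have hshift : Measurable fun ω t => deHaanField E Zc ω (t + h) :=
    measurable_pi_lambda _ fun t => (measurable_pi_apply _).comp hX.measurable_deHaanField
  have hlaw := congrArg (fun ν => ν {f | (n : ℝ≥0∞) < weightedMax s f}) (hstat h)
  beta_reduce at hlaw
  rw [Measure.map_apply hshift hset, Measure.map_apply hX.measurable_deHaanField hset] at hlaw
  simp only [← weightedMax_comp s (· + h)]
  exact congrArg _ hlaw.symm

end DeHaan

/-! ### The space of càdlàg paths -/

/-- The space of càdlàg paths, with the trace of the product σ-field. Unlike `FieldPath d` it has a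
jointly measurable evaluation map. -/
abbrev CadlagPath (d : ℕ) : Type := {f : FieldPath d // IsCadlag f}

namespace IsCadlag

variable {d : ℕ} {f : FieldPath d}

lemma const_mul (hf : IsCadlag f) (c : ℝ≥0) : IsCadlag fun t => c * f t := fun t =>
  ⟨fun ρ => ((hf t).1 ρ).imp' (fun l => c * l) fun _ hl => hl.const_mul c, (hf t).2.const_mul c⟩

lemma comp_add (hf : IsCadlag f) (τ : Fin d → ℝ) : IsCadlag fun t => f (t + τ) := by
  intro t
  have hcont : Tendsto (fun s : Fin d → ℝ => s + τ) (𝓝 t) (𝓝 (t + τ)) :=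
    (continuous_add_const τ).tendsto t
  refine ⟨fun ρ => ((hf (t + τ)).1 ρ).imp fun l hl => hl.comp ?_, (hf (t + τ)).2.tendsto.comp ?_⟩
  · refine tendsto_nhdsWithin_iff.2 ⟨hcont.mono_left nhdsWithin_le_nhds, ?_⟩
    filter_upwards [self_mem_nhdsWithin] with s hs i
    have := hs i
    split_ifs with h <;> simpa [h] using this
  · refine tendsto_nhdsWithin_iff.2 ⟨hcont.mono_left nhdsWithin_le_nhds, ?_⟩
    filter_upwards [self_mem_nhdsWithin] with s hs
    exact add_le_add_left (show t ≤ s from hs) τ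

lemma zero : IsCadlag (0 : FieldPath d) := fun _ =>
  ⟨fun _ => ⟨0, tendsto_const_nhds⟩, continuousWithinAt_const⟩

end IsCadlag

namespace CadlagPath

variable {d : ℕ}

/-- The path `f` multiplied by the constant `c`. -/
def scale (c : ℝ≥0) (f : CadlagPath d) : CadlagPath d := ⟨fun t => c * f.1 t, f.2.const_mul c⟩

/-- The translated path `t ↦ f (t + τ)`. -/
def shift (τ : Fin d → ℝ) (f : CadlagPath d) : CadlagPath d :=
  ⟨fun t => f.1 (t + τ), f.2.comp_add τ⟩

@[simp] lemma scale_apply (c : ℝ≥0) (f : CadlagPath d) (t : Fin d → ℝ) :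
    (scale c f).1 t = c * f.1 t := rfl

@[simp] lemma shift_apply (τ : Fin d → ℝ) (f : CadlagPath d) (t : Fin d → ℝ) :
    (shift τ f).1 t = f.1 (t + τ) := rfl

lemma shift_shift (σ τ : Fin d → ℝ) (f : CadlagPath d) :
    shift σ (shift τ f) = shift (σ + τ) f := by
  ext t
  simp [add_assoc]

@[simp] lemma shift_zero (f : CadlagPath d) : shift 0 f = f := by
  ext t
  simp

lemma shift_scale (c : ℝ≥0) (τ : Fin d → ℝ) (f : CadlagPath d) :
    shift τ (scale c f) = scale c (shift τ f) := rfl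

@[fun_prop]
lemma measurable_apply (t : Fin d → ℝ) : Measurable fun f : CadlagPath d => f.1 t :=
  (measurable_pi_apply t).comp measurable_subtype_coe

@[fun_prop]
lemma measurable_shift (τ : Fin d → ℝ) : Measurable (shift τ : CadlagPath d → CadlagPath d) :=
  Measurable.subtype_mk (measurable_pi_lambda _ fun _ => measurable_apply _)

lemma measurable_scale_uncurry :
    Measurable fun p : ℝ≥0 × CadlagPath d => scale p.1 p.2 :=
  Measurable.subtype_mk (measurable_pi_lambda _ fun t =>
    measurable_fst.mul ((measurable_apply t).comp measurable_snd))

/-- The smallest point of `(n + 1)⁻¹ ℤᵈ` above `t`. As `n → ∞` these points approach `t` from the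
upper quadrant, where a càdlàg path is continuous. -/
noncomputable def gridCeil (n : ℕ) (t : Fin d → ℝ) : Fin d → ℝ :=
  fun i => (⌈((n : ℝ) + 1) * t i⌉ : ℤ) / ((n : ℝ) + 1)

lemma le_gridCeil (n : ℕ) (t : Fin d → ℝ) : t ≤ gridCeil n t := fun i => by
  have : (0 : ℝ) < (n : ℝ) + 1 := by positivity
  rw [gridCeil, le_div_iff₀ this, mul_comm]
  exact Int.le_ceil _

lemma gridCeil_apply_le (n : ℕ) (t : Fin d → ℝ) (i : Fin d) :
    gridCeil n t i ≤ t i + 1 / ((n : ℝ) + 1) := by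
  have : (0 : ℝ) < (n : ℝ) + 1 := by positivity
  rw [gridCeil, div_le_iff₀ this, add_mul (t i), one_div, inv_mul_cancel₀ this.ne', mul_comm (t i)]
  exact (Int.ceil_lt_add_one _).le

lemma tendsto_gridCeil (t : Fin d → ℝ) : Tendsto (fun n => gridCeil n t) atTop (𝓝[Ici t] t) := by
  refine tendsto_nhdsWithin_iff.2 ⟨tendsto_pi_nhds.2 fun i => ?_, Eventually.of_forall fun n =>
    le_gridCeil n t⟩
  refine tendsto_of_tendsto_of_tendsto_of_le_of_le tendsto_const_nhds ?_
    (fun n => le_gridCeil n t i) fun n => gridCeil_apply_le n t i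
  simpa using tendsto_one_div_add_atTop_nhds_zero_nat.const_add (t i)

lemma tendsto_apply_gridCeil (f : CadlagPath d) (t : Fin d → ℝ) :
    Tendsto (fun n => f.1 (gridCeil n t)) atTop (𝓝 (f.1 t)) :=
  (f.2 t).2.tendsto.comp (tendsto_gridCeil t)

lemma exists_rat_pos {f : CadlagPath d} (h : ∃ t, 0 < f.1 t) :
    ∃ q : Fin d → ℚ, 0 < f.1 (fun i => (q i : ℝ)) := by
  obtain ⟨t, ht⟩ := h
  obtain ⟨n, hn⟩ := ((tendsto_apply_gridCeil f t).eventually (lt_mem_nhds ht)).exists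
  refine ⟨fun i => (⌈((n : ℝ) + 1) * t i⌉ : ℤ) / ((n : ℚ) + 1), ?_⟩
  convert hn using 2
  ext i
  simp [gridCeil]

lemma measurable_eval : Measurable fun p : CadlagPath d × (Fin d → ℝ) => p.1.1 p.2 := by
  refine measurable_of_tendsto_metrizable
    (f := fun n (p : CadlagPath d × (Fin d → ℝ)) => p.1.1 (gridCeil n p.2)) (fun n => ?_)
    (tendsto_pi_nhds.2 fun p => tendsto_apply_gridCeil p.1 p.2)
  have heval : Measurable fun q : CadlagPath d × (Fin d → ℤ) =>
      q.1.1 (fun i => (q.2 i : ℝ) / ((n : ℝ) + 1)) :=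
    measurable_from_prod_countable_left fun k =>
      measurable_apply fun i => (k i : ℝ) / ((n : ℝ) + 1)
  have hceil : Measurable fun p : CadlagPath d × (Fin d → ℝ) =>
      (p.1, fun i => ⌈((n : ℝ) + 1) * p.2 i⌉) :=
    measurable_fst.prodMk (measurable_pi_lambda _ fun i =>
      Int.measurable_ceil.comp (((measurable_pi_apply i).comp measurable_snd).const_mul _))
  exact heval.comp hceil

lemma measurable_coe (f : CadlagPath d) : Measurable f.1 :=
  measurable_eval.comp measurable_prodMk_left

end CadlagPath

/-- `Y` is a measurable map into the space of càdlàg paths that almost surely agrees with the field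
`Z`. -/
structure IsCadlagModification {d : ℕ} {Ω : Type*} [MeasurableSpace Ω] (P : Measure Ω)
    (Z : Ω → FieldPath d) (Y : Ω → CadlagPath d) : Prop where
  measurable : Measurable Y
  ae_eq : ∀ᵐ ω ∂P, (Y ω).1 = Z ω

lemma exists_isCadlagModification {d : ℕ} {Ω : Type*} [MeasurableSpace Ω] {P : Measure Ω}
    {Z : Ω → FieldPath d} (hZ : Measurable Z) (hcad : ∀ᵐ ω ∂P, IsCadlag (Z ω)) :
    ∃ Y, IsCadlagModification P Z Y := by
  classical
  obtain ⟨N, hN, hNmeas, hNnull⟩ := exists_measurable_superset_of_null (ae_iff.1 hcad)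
  have hcad' (ω : Ω) : IsCadlag (if ω ∈ N then 0 else Z ω) := by
    split_ifs with h
    · exact IsCadlag.zero
    · by_contra h'
      exact h (hN h')
  refine ⟨fun ω => ⟨_, hcad' ω⟩,
    Measurable.subtype_mk (Measurable.ite hNmeas measurable_const hZ), ?_⟩
  filter_upwards [measure_eq_zero_iff_ae_notMem.1 hNnull] with ω hω
  simp [hω]

/-! ### Shift invariance of expectations of homogeneous functionals -/

lemma natCast_mul_max_sub_max_le (y m : ℝ≥0) (n : ℕ) :
    n * (max ((1 + (n : ℝ≥0)⁻¹) * y) m - max y m) ≤ y := by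
  have hmax : max ((1 + (n : ℝ≥0)⁻¹) * y) m ≤ (n : ℝ≥0)⁻¹ * y + max y m := by
    refine max_le ?_ ((le_max_right _ _).trans le_add_self)
    rw [add_mul, one_mul, add_comm]
    gcongr
    exact le_max_left _ _
  calc n * (max ((1 + (n : ℝ≥0)⁻¹) * y) m - max y m)
    _ ≤ n * ((n : ℝ≥0)⁻¹ * y) := by
      gcongr
      exact tsub_le_iff_right.2 hmax
    _ ≤ 1 * y := by
      rw [← mul_assoc]
      gcongr
      exact mul_inv_le_one
    _ = y := one_mul y

lemma tendsto_natCast_mul_max_sub_max (y m : ℝ≥0) :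
    Tendsto (fun n : ℕ => (n : ℝ≥0) * (max ((1 + (n : ℝ≥0)⁻¹) * y) m - max y m)) atTop
      (𝓝 (if m ≤ y then y else 0)) := by
  split_ifs with h
  · refine tendsto_const_nhds.congr' ?_
    filter_upwards [eventually_ne_atTop 0] with n hn
    have hy : y ≤ (1 + (n : ℝ≥0)⁻¹) * y := le_mul_of_one_le_left' le_self_add
    rw [max_eq_left h, max_eq_left (h.trans hy), add_mul, one_mul, add_tsub_cancel_left,
      mul_inv_cancel_left₀ (by exact_mod_cast hn)]
  · have hlim : Tendsto (fun n : ℕ => (1 + (n : ℝ≥0)⁻¹) * y) atTop (𝓝 y) := by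
      simpa using (tendsto_inv_atTop_nhds_zero_nat (𝕜 := ℝ≥0)).const_add 1 |>.mul_const y
    refine tendsto_const_nhds.congr' ?_
    filter_upwards [hlim.eventually (gt_mem_nhds (not_le.1 h))] with n hn
    rw [max_eq_right hn.le, max_eq_right (not_le.1 h).le, tsub_self, mul_zero]

/- The right derivative of `c ↦ ∫ max (c Y) m` at `c = 1`. -/
lemma tendsto_natCast_mul_lintegral_max_sub {α : Type*} [MeasurableSpace α] {μ : Measure α}
    {Y m : α → ℝ≥0} (hY : Measurable Y) (hm : Measurable m) (hYint : ∫⁻ a, Y a ∂μ ≠ ∞)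
    (hmint : ∫⁻ a, m a ∂μ ≠ ∞) :
    Tendsto (fun n : ℕ => (n : ℝ≥0∞) *
      (∫⁻ a, (max ((1 + (n : ℝ≥0)⁻¹) * Y a) (m a) : ℝ≥0) ∂μ - ∫⁻ a, (max (Y a) (m a) : ℝ≥0) ∂μ))
      atTop (𝓝 (∫⁻ a in {a | m a ≤ Y a}, Y a ∂μ)) := by
  have hmaxint : ∫⁻ a, (max (Y a) (m a) : ℝ≥0) ∂μ ≠ ∞ := by
    refine ne_top_of_le_ne_top (ENNReal.add_ne_top.2 ⟨hYint, hmint⟩) ?_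
    rw [← lintegral_add_left hY.coe_nnreal_ennreal]
    refine lintegral_mono fun a => ?_
    rw [← ENNReal.coe_add, ENNReal.coe_le_coe]
    exact max_le le_self_add le_add_self
  have hquot (n : ℕ) : (n : ℝ≥0∞) *
      (∫⁻ a, (max ((1 + (n : ℝ≥0)⁻¹) * Y a) (m a) : ℝ≥0) ∂μ - ∫⁻ a, (max (Y a) (m a) : ℝ≥0) ∂μ) =
      ∫⁻ a, (n * (max ((1 + (n : ℝ≥0)⁻¹) * Y a) (m a) - max (Y a) (m a)) : ℝ≥0) ∂μ := by
    rw [← lintegral_sub (by fun_prop) hmaxint, ← lintegral_const_mul' _ _ (by simp)]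
    · simp
    · refine Eventually.of_forall fun a => ENNReal.coe_le_coe.2 (max_le_max ?_ le_rfl)
      exact le_mul_of_one_le_left' le_self_add
  simp only [hquot]
  rw [← lintegral_indicator (measurableSet_le hm hY)]
  refine tendsto_lintegral_of_dominated_convergence (fun a => (Y a : ℝ≥0∞)) (fun n => by fun_prop)
    (fun n => Eventually.of_forall fun a =>
      ENNReal.coe_le_coe.2 (natCast_mul_max_sub_max_le (Y a) (m a) n)) hYint
    (Eventually.of_forall fun a => ?_)
  have := ENNReal.tendsto_coe.2 (tendsto_natCast_mul_max_sub_max (Y a) (m a))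
  by_cases h : m a ≤ Y a <;> simpa [indicator, h] using this

section WeightedMaxSets

variable {ι : Type*}

lemma isPiSystem_weightedMax_le :
    IsPiSystem {S : Set (ι → ℝ≥0) | ∃ s, S = {f | weightedMax s f ≤ 1}} := by
  classical
  rintro _ ⟨s, rfl⟩ _ ⟨s', rfl⟩ -
  refine ⟨s ∪ s', ?_⟩
  ext f
  simp [weightedMax, Finset.sup_union]

lemma generateFrom_weightedMax_le :
    MeasurableSpace.generateFrom {S : Set (ι → ℝ≥0) | ∃ s, S = {f | weightedMax s f ≤ 1}} =
      MeasurableSpace.pi := by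
  apply le_antisymm
  · refine MeasurableSpace.generateFrom_le ?_
    rintro _ ⟨s, rfl⟩
    exact measurableSet_le (measurable_weightedMax s) measurable_const
  refine iSup_le fun t => ?_
  rw [← measurable_iff_comap_le]
  have hpos {c : ℝ≥0} (hc : 0 < c) : MeasurableSet[MeasurableSpace.generateFrom
      {S : Set (ι → ℝ≥0) | ∃ s, S = {f | weightedMax s f ≤ 1}}] {f | f t ≤ c} := by
    refine MeasurableSpace.measurableSet_generateFrom ⟨{(t, c⁻¹)}, ?_⟩
    ext f
    simp [weightedMax, inv_mul_le_iff₀ hc]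
  refine @measurable_of_Iic ℝ≥0 (ι → ℝ≥0) _ _ _ (_) _ _ _ _ fun c => ?_
  have hinter : (fun f : ι → ℝ≥0 => f t) ⁻¹' Iic c =
      ⋂ n : ℕ, {f | f t ≤ c + 1 / ((n : ℝ≥0) + 1)} := by
    ext f
    simp only [mem_preimage, mem_Iic, mem_iInter, mem_ofPred_eq]
    refine ⟨fun h n => h.trans le_self_add, fun h => ?_⟩
    refine ge_of_tendsto' (f := fun n : ℕ => c + 1 / ((n : ℝ≥0) + 1)) (x := atTop) ?_ h
    simpa using (tendsto_one_div_add_atTop_nhds_zero_nat (𝕜 := ℝ≥0)).const_add c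
  rw [hinter]
  exact MeasurableSet.iInter fun n => hpos (by positivity)

lemma ext_of_measure_weightedMax_le {p : (ι → ℝ≥0) → Prop} {μ ν : Measure {f // p f}}
    [IsFiniteMeasure μ]
    (h : ∀ s, μ {f | weightedMax s f.1 ≤ 1} = ν {f | weightedMax s f.1 ≤ 1}) : μ = ν := by
  have hgen : (Subtype.instMeasurableSpace : MeasurableSpace {f // p f}) =
      MeasurableSpace.generateFrom
        (preimage Subtype.val '' {S : Set (ι → ℝ≥0) | ∃ s, S = {f | weightedMax s f ≤ 1}}) := by
    rw [← MeasurableSpace.comap_generateFrom, generateFrom_weightedMax_le]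
    rfl
  refine ext_of_generate_finite _ hgen (isPiSystem_weightedMax_le.comap Subtype.val) ?_ ?_
  · rintro _ ⟨_, ⟨s, rfl⟩, rfl⟩
    exact h s
  · simpa [weightedMax] using h ∅

end WeightedMaxSets

namespace CadlagPath

variable {d : ℕ} {μ : Measure (CadlagPath d)}

/-- The properties of the law of the spectral field on which shift invariance rests: mean one,
paths that do not vanish identically, and shift invariance of the expected weighted maxima. -/
structure IsMaxInvariant (μ : Measure (CadlagPath d)) : Prop where
  mean_one : ∀ t, ∫⁻ f, (f.1 t : ℝ≥0∞) ∂μ = 1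
  nonzero : ∀ᵐ f ∂μ, ∃ t, 0 < f.1 t
  max_shift : ∀ s h, ∫⁻ f, (weightedMax s (shift h f).1 : ℝ≥0) ∂μ =
    ∫⁻ f, (weightedMax s f.1 : ℝ≥0) ∂μ

/-- Functionals of paths that are homogeneous of degree one. -/
def IsHomogeneous (G : CadlagPath d → ℝ≥0∞) : Prop :=
  ∀ (c : ℝ≥0) (f : CadlagPath d), 0 < c → G (scale c f) = c * G f

/-- Sets of paths that are closed under multiplication by positive constants. -/
def IsScaleInvariant (B : Set (CadlagPath d)) : Prop :=
  ∀ (c : ℝ≥0) (f : CadlagPath d), 0 < c → (scale c f ∈ B ↔ f ∈ B)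

lemma IsHomogeneous.indicator {G : CadlagPath d → ℝ≥0∞} (hG : IsHomogeneous G)
    {B : Set (CadlagPath d)} (hB : IsScaleInvariant B) : IsHomogeneous (B.indicator G) := by
  intro c f hc
  by_cases hf : f ∈ B
  · rw [indicator_of_mem hf, indicator_of_mem ((hB c f hc).2 hf), hG c f hc]
  · rw [indicator_of_notMem hf, indicator_of_notMem (mt (hB c f hc).1 hf), mul_zero]

/-- The path `shift τ f` normalised by its value at `t`. -/
noncomputable def normalize (t τ : Fin d → ℝ) (f : CadlagPath d) : CadlagPath d :=
  scale (f.1 (t + τ))⁻¹ (shift τ f)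

@[fun_prop]
lemma measurable_normalize (t τ : Fin d → ℝ) :
    Measurable (normalize t τ : CadlagPath d → CadlagPath d) :=
  measurable_scale_uncurry.comp ((measurable_apply _).inv.prodMk (measurable_shift τ))

/-- The law of the shifted path `shift τ f` normalised by its value at `t`, under the measure `μ`
tilted by that value. For `t = τ = 0` and `μ` the law of `Z` this is the law of `Θ`. -/
noncomputable def tiltedLaw (μ : Measure (CadlagPath d)) (t τ : Fin d → ℝ) :
    Measure (CadlagPath d) :=
  (μ.withDensity fun f => (f.1 (t + τ) : ℝ≥0∞)).map (normalize t τ)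

lemma lintegral_tiltedLaw (μ : Measure (CadlagPath d)) (t τ : Fin d → ℝ) {g : CadlagPath d → ℝ≥0∞}
    (hg : Measurable g) :
    ∫⁻ f, g f ∂(tiltedLaw μ t τ) = ∫⁻ f, f.1 (t + τ) * g (normalize t τ f) ∂μ := by
  rw [tiltedLaw, lintegral_map hg (measurable_normalize t τ)]
  exact lintegral_withDensity_eq_lintegral_mul _ (measurable_apply _).coe_nnreal_ennreal
    (hg.comp (measurable_normalize t τ))

lemma tiltedLaw_apply (μ : Measure (CadlagPath d)) (t τ : Fin d → ℝ) {A : Set (CadlagPath d)}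
    (hA : MeasurableSet A) :
    tiltedLaw μ t τ A = ∫⁻ f in normalize t τ ⁻¹' A, f.1 (t + τ) ∂μ := by
  rw [tiltedLaw, Measure.map_apply (measurable_normalize t τ) hA,
    withDensity_apply _ (measurable_normalize t τ hA)]

lemma measurable_weightedMax_shift (s : Finset ((Fin d → ℝ) × ℝ≥0)) (τ : Fin d → ℝ) :
    Measurable fun f : CadlagPath d => weightedMax s (shift τ f).1 :=
  (measurable_weightedMax s).comp (measurable_subtype_coe.comp (measurable_shift τ))

lemma tiltedLaw_weightedMax_le (μ : Measure (CadlagPath d)) (t τ : Fin d → ℝ)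
    (s : Finset ((Fin d → ℝ) × ℝ≥0)) :
    tiltedLaw μ t τ {f | weightedMax s f.1 ≤ 1} =
      ∫⁻ f in {f | weightedMax s (shift τ f).1 ≤ f.1 (t + τ)}, f.1 (t + τ) ∂μ := by
  have hset : MeasurableSet {f : CadlagPath d | weightedMax s f.1 ≤ 1} :=
    measurableSet_le ((measurable_weightedMax s).comp measurable_subtype_coe) measurable_const
  rw [tiltedLaw_apply μ t τ hset, ← lintegral_indicator (measurable_normalize t τ hset),
    ← lintegral_indicator (measurableSet_le (measurable_weightedMax_shift s τ)
      (measurable_apply _))]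
  refine lintegral_congr fun f => ?_
  rcases eq_or_ne (f.1 (t + τ)) 0 with h0 | h0
  · simp [indicator, h0]
  · have hscale : weightedMax s (normalize t τ f).1 =
        (f.1 (t + τ))⁻¹ * weightedMax s (shift τ f).1 :=
      weightedMax_mul s _ _
    simp only [indicator, mem_preimage, mem_ofPred_eq, hscale,
      inv_mul_le_iff₀ (pos_iff_ne_zero.2 h0), mul_one]

namespace IsMaxInvariant

lemma lintegral_weightedMax_ne_top (hμ : IsMaxInvariant μ) (s : Finset ((Fin d → ℝ) × ℝ≥0)) :
    ∫⁻ f : CadlagPath d, (weightedMax s f.1 : ℝ≥0) ∂μ ≠ ∞ := by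
  have hle (f : CadlagPath d) : ((weightedMax s f.1 : ℝ≥0) : ℝ≥0∞) ≤
      ∑ p ∈ s, (p.2 : ℝ≥0∞) * f.1 p.1 := by
    rw [coe_weightedMax]
    exact Finset.sup_le fun p hp => Finset.single_le_sum
      (f := fun p : (Fin d → ℝ) × ℝ≥0 => (p.2 : ℝ≥0∞) * f.1 p.1) (fun _ _ => zero_le) hp
  refine ne_top_of_le_ne_top ?_ (lintegral_mono hle)
  rw [lintegral_finsetSum _ fun p _ => by fun_prop]
  refine ENNReal.sum_ne_top.2 fun p _ => ?_
  rw [lintegral_const_mul' _ _ ENNReal.coe_ne_top, hμ.mean_one]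
  simp

lemma lintegral_max_mul_weightedMax_shift [DecidableEq ((Fin d → ℝ) × ℝ≥0)]
    (hμ : IsMaxInvariant μ) (t τ : Fin d → ℝ) (c : ℝ≥0) (s : Finset ((Fin d → ℝ) × ℝ≥0)) :
    ∫⁻ f, (max (c * f.1 (t + τ)) (weightedMax s (shift τ f).1) : ℝ≥0) ∂μ =
      ∫⁻ f, (weightedMax (insert (t, c) s) f.1 : ℝ≥0) ∂μ := by
  rw [← hμ.max_shift _ τ]
  simp [weightedMax, Finset.sup_insert]

/- The law of the normalised path is determined by the sets `{f | weightedMax s f ≤ 1}`, whose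
tilted measures are derivatives of expected weighted maxima and hence shift invariant. -/
lemma tiltedLaw_eq (hμ : IsMaxInvariant μ) (t τ : Fin d → ℝ) :
    tiltedLaw μ t τ = tiltedLaw μ t 0 := by
  classical
  have hfin : IsFiniteMeasure (tiltedLaw μ t τ) := ⟨by
    simp [tiltedLaw_apply μ t τ MeasurableSet.univ, hμ.mean_one]⟩
  refine ext_of_measure_weightedMax_le fun s => ?_
  rw [tiltedLaw_weightedMax_le, tiltedLaw_weightedMax_le]
  have hlim (τ : Fin d → ℝ) := tendsto_natCast_mul_lintegral_max_sub (μ := μ)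
    (measurable_apply (t + τ)) (measurable_weightedMax_shift s τ) (by simp [hμ.mean_one])
    (by simpa only [hμ.max_shift] using hμ.lintegral_weightedMax_ne_top s)
  have hmax (τ : Fin d → ℝ) :
      ∫⁻ f, (max (f.1 (t + τ)) (weightedMax s (shift τ f).1) : ℝ≥0) ∂μ =
        ∫⁻ f, (weightedMax (insert (t, 1) s) f.1 : ℝ≥0) ∂μ := by
    simpa only [one_mul] using hμ.lintegral_max_mul_weightedMax_shift t τ 1 s
  simp only [hμ.lintegral_max_mul_weightedMax_shift, hmax] at hlim
  exact tendsto_nhds_unique (hlim τ) (hlim 0)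

end IsMaxInvariant

lemma lintegral_tiltedLaw_of_isHomogeneous {G : CadlagPath d → ℝ≥0∞} (hGmeas : Measurable G)
    (hG : IsHomogeneous G) {t : Fin d → ℝ} (hzero : ∀ f, f.1 t = 0 → G f = 0) (τ : Fin d → ℝ) :
    ∫⁻ f, G f ∂(tiltedLaw μ t τ) = ∫⁻ f, G (shift τ f) ∂μ := by
  rw [lintegral_tiltedLaw μ t τ hGmeas]
  refine lintegral_congr fun f => ?_
  rcases eq_or_ne (f.1 (t + τ)) 0 with h0 | h0
  · rw [h0, hzero (shift τ f) h0, ENNReal.coe_zero, zero_mul]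
  · rw [normalize, hG _ _ (inv_pos.2 (pos_iff_ne_zero.2 h0)), ← mul_assoc, ← ENNReal.coe_mul,
      mul_inv_cancel₀ h0, ENNReal.coe_one, one_mul]

/-- The paths that are positive at `u k` and vanish at the earlier points `u 0, …, u (k - 1)`. -/
def firstPositive (u : ℕ → Fin d → ℝ) (k : ℕ) : Set (CadlagPath d) :=
  disjointed (fun j => {f : CadlagPath d | 0 < f.1 (u j)}) k

lemma firstPositive_subset (u : ℕ → Fin d → ℝ) (k : ℕ) :
    firstPositive u k ⊆ {f | 0 < f.1 (u k)} :=
  disjointed_subset _ k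

lemma measurableSet_firstPositive (u : ℕ → Fin d → ℝ) (k : ℕ) :
    MeasurableSet (firstPositive u k) :=
  MeasurableSet.disjointed (fun _ => measurableSet_lt measurable_const (measurable_apply _)) k

lemma isScaleInvariant_firstPositive (u : ℕ → Fin d → ℝ) (k : ℕ) :
    IsScaleInvariant (firstPositive u k) := by
  intro c f hc
  simp [firstPositive, disjointed_eq_inter_compl, hc]

lemma lintegral_shift_eq_tsum {u : ℕ → Fin d → ℝ} (G : CadlagPath d → ℝ≥0∞) (τ : Fin d → ℝ)
    (hu : ∀ᵐ f ∂μ, ∃ k, 0 < (shift τ f).1 (u k)) :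
    ∫⁻ f, G (shift τ f) ∂μ = ∑' k, ∫⁻ f, (firstPositive u k).indicator G (shift τ f) ∂μ := by
  have hmeas (k : ℕ) : MeasurableSet (shift τ ⁻¹' firstPositive u k) :=
    measurable_shift τ (measurableSet_firstPositive u k)
  have hdisj : Pairwise (Function.onFun Disjoint fun k => shift τ ⁻¹' firstPositive u k) :=
    fun j k hjk => (disjoint_disjointed _ hjk).preimage _
  have huniv : (univ : Set (CadlagPath d)) =ᵐ[μ] ⋃ k, shift τ ⁻¹' firstPositive u k := by
    refine (eventuallyEq_univ.2 ?_).symm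
    filter_upwards [hu] with f hf
    rw [← preimage_iUnion]
    simpa only [firstPositive, iUnion_disjointed, preimage_iUnion, mem_iUnion, mem_preimage,
      mem_ofPred_eq] using hf
  calc ∫⁻ f, G (shift τ f) ∂μ
    _ = ∫⁻ f in ⋃ k, shift τ ⁻¹' firstPositive u k, G (shift τ f) ∂μ := by
      rw [← setLIntegral_univ, setLIntegral_congr huniv]
    _ = ∑' k, ∫⁻ f in shift τ ⁻¹' firstPositive u k, G (shift τ f) ∂μ :=
      lintegral_iUnion hmeas hdisj _
    _ = _ := tsum_congr fun k => (lintegral_indicator (hmeas k) _).symm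

theorem IsMaxInvariant.lintegral_shift (hμ : IsMaxInvariant μ) {G : CadlagPath d → ℝ≥0∞}
    (hGmeas : Measurable G) (hG : IsHomogeneous G) (τ : Fin d → ℝ) :
    ∫⁻ f, G (shift τ f) ∂μ = ∫⁻ f, G f ∂μ := by
  obtain ⟨q, hq⟩ := exists_surjective_nat (Fin d → ℚ)
  let u : ℕ → Fin d → ℝ := fun k i => (q k i : ℝ)
  have hpos (τ : Fin d → ℝ) : ∀ᵐ f ∂μ, ∃ k, 0 < (shift τ f).1 (u k) := by
    filter_upwards [hμ.nonzero] with f ⟨t, ht⟩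
    obtain ⟨r, hr⟩ := exists_rat_pos (f := shift τ f) ⟨t - τ, by simpa using ht⟩
    obtain ⟨k, rfl⟩ := hq r
    exact ⟨k, hr⟩
  have htilted (τ : Fin d → ℝ) (k : ℕ) :
      ∫⁻ f, (firstPositive u k).indicator G (shift τ f) ∂μ =
        ∫⁻ f, (firstPositive u k).indicator G f ∂(tiltedLaw μ (u k) 0) := by
    rw [← hμ.tiltedLaw_eq (u k) τ, lintegral_tiltedLaw_of_isHomogeneous
      (hGmeas.indicator (measurableSet_firstPositive u k))
      (hG.indicator (isScaleInvariant_firstPositive u k))]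
    exact fun f hf => indicator_of_notMem (fun h => (firstPositive_subset u k h).ne' hf) _
  have hsum (τ : Fin d → ℝ) : ∫⁻ f, G (shift τ f) ∂μ =
      ∑' k, ∫⁻ f, (firstPositive u k).indicator G f ∂(tiltedLaw μ (u k) 0) :=
    (lintegral_shift_eq_tsum G τ (hpos τ)).trans (tsum_congr (htilted τ))
  simpa only [shift_zero] using (hsum τ).trans (hsum 0).symm

end CadlagPath

/-! ### The measures `λ_δ` and the sojourn functionals -/

section Lam

variable {d : ℕ} {δ : ℝ≥0}

instance sFinite_lam (d : ℕ) (δ : ℝ≥0) : SFinite (lam d δ) := by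
  unfold lam
  split_ifs <;> infer_instance

lemma lam_zero (d : ℕ) : lam d 0 = volume := if_pos rfl

/-- The lattice point `h k`. -/
noncomputable def latticePoint (h : ℝ≥0) (k : Fin d → ℤ) : Fin d → ℝ :=
  fun i => (h : ℝ) * (k i : ℝ)

lemma latticePoint_add (h : ℝ≥0) (j k : Fin d → ℤ) :
    latticePoint h (j + k) = latticePoint h j + latticePoint h k := by
  ext i
  simp [latticePoint, mul_add]

@[simp] lemma latticePoint_zero (h : ℝ≥0) : latticePoint h (0 : Fin d → ℤ) = 0 := by
  ext i
  simp [latticePoint]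

lemma lam_apply_of_ne_zero (hδ : δ ≠ 0) {A : Set (Fin d → ℝ)} (hA : MeasurableSet A) :
    lam d δ A = (δ : ℝ≥0∞) ^ d * ∑' k : Fin d → ℤ, A.indicator 1 (latticePoint δ k) := by
  rw [lam, if_neg hδ, Measure.smul_apply, Measure.sum_apply _ hA, smul_eq_mul]
  simp only [Measure.dirac_apply' _ hA]
  rfl

/-- The translation by `τ` preserves `λ_δ`. -/
def IsLamShift (d : ℕ) (δ : ℝ≥0) (τ : Fin d → ℝ) : Prop :=
  MeasurePreserving (fun t => t + τ) (lam d δ) (lam d δ)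

lemma isLamShift_zero (τ : Fin d → ℝ) : IsLamShift d 0 τ := by
  rw [IsLamShift, lam_zero]
  exact measurePreserving_add_right volume τ

lemma isLamShift_latticePoint (δ : ℝ≥0) (j : Fin d → ℤ) :
    IsLamShift d δ (latticePoint δ j) := by
  rcases eq_or_ne δ 0 with rfl | hδ
  · exact isLamShift_zero _
  have hmeas : Measurable fun t : Fin d → ℝ => t + latticePoint δ j := by fun_prop
  refine ⟨hmeas, Measure.ext fun A hA => ?_⟩
  rw [Measure.map_apply hmeas hA, lam_apply_of_ne_zero hδ (hmeas hA), lam_apply_of_ne_zero hδ hA,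
    ← (Equiv.addRight j).tsum_eq fun k : Fin d → ℤ =>
      A.indicator (1 : (Fin d → ℝ) → ℝ≥0∞) (latticePoint δ k)]
  simp only [Equiv.coe_addRight, latticePoint_add]
  rfl

lemma ae_isLamShift (d : ℕ) (δ : ℝ≥0) : ∀ᵐ t ∂(lam d δ), IsLamShift d δ t := by
  rcases eq_or_ne δ 0 with rfl | hδ
  · exact Eventually.of_forall isLamShift_zero
  · rw [lam, if_neg hδ]
    refine Measure.ae_smul_measure ?_ _
    rw [Measure.ae_sum_iff]
    intro k
    rw [ae_dirac_eq]
    exact isLamShift_latticePoint δ k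

/-- The side of the half-open cubes into which `ℝᵈ` is divided: `δ`, so that every cube contains
exactly one point of `δ ℤᵈ`, or `1` when `δ = 0`. -/
noncomputable def cubeSide (δ : ℝ≥0) : ℝ≥0 := if δ = 0 then 1 else δ

lemma cubeSide_pos (δ : ℝ≥0) : 0 < cubeSide δ := by
  unfold cubeSide
  split_ifs with h
  · exact one_pos
  · exact pos_iff_ne_zero.2 h

lemma isLamShift_latticePoint_cubeSide (δ : ℝ≥0) (k : Fin d → ℤ) :
    IsLamShift d δ (latticePoint (cubeSide δ) k) := by
  rcases eq_or_ne δ 0 with rfl | hδ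
  · exact isLamShift_zero _
  · rw [cubeSide, if_neg hδ]
    exact isLamShift_latticePoint δ k

/-- The index of the half-open cube of side `h` that contains `t`. -/
noncomputable def cubeIndex (h : ℝ≥0) (t : Fin d → ℝ) : Fin d → ℤ := fun i => ⌊t i / h⌋

@[simp] lemma cubeIndex_zero (h : ℝ≥0) : cubeIndex h (0 : Fin d → ℝ) = 0 := by
  ext i
  simp [cubeIndex]

lemma measurable_cubeIndex (h : ℝ≥0) : Measurable (cubeIndex (d := d) h) :=
  measurable_pi_lambda _ fun i => Int.measurable_floor.comp ((measurable_pi_apply i).div_const _)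

lemma cubeIndex_add_latticePoint {h : ℝ≥0} (hh : 0 < h) (t : Fin d → ℝ) (k : Fin d → ℤ) :
    cubeIndex h (t + latticePoint h k) = cubeIndex h t + k := by
  ext i
  have : (h : ℝ) ≠ 0 := by exact_mod_cast hh.ne'
  simp [cubeIndex, latticePoint, add_div, mul_div_cancel_left₀ _ this]

lemma cubeIndex_latticePoint {h : ℝ≥0} (hh : 0 < h) (k : Fin d → ℤ) :
    cubeIndex h (latticePoint h k) = k := by
  simpa using cubeIndex_add_latticePoint hh 0 k

/-- The union of the cubes of side `h` with indices in `J`. -/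
def cubes (h : ℝ≥0) (J : Set (Fin d → ℤ)) : Set (Fin d → ℝ) := cubeIndex h ⁻¹' J

lemma measurableSet_cubes (h : ℝ≥0) (J : Set (Fin d → ℤ)) : MeasurableSet (cubes h J) :=
  measurable_cubeIndex h (to_countable J).measurableSet

lemma lam_cube (d : ℕ) (δ : ℝ≥0) :
    lam d δ (cubes (cubeSide δ) {0}) = (cubeSide δ : ℝ≥0∞) ^ d := by
  rcases eq_or_ne δ 0 with rfl | hδ
  · have hcube : cubes (cubeSide 0) {0} = Set.pi univ fun _ : Fin d => Ico (0 : ℝ) 1 := by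
      ext t
      simp [cubes, cubeIndex, cubeSide, funext_iff, Int.floor_eq_zero_iff, Set.mem_pi]
    rw [hcube, lam_zero, volume_pi_pi]
    simp [cubeSide]
  · have hmem (k : Fin d → ℤ) : latticePoint δ k ∈ cubes δ {0} ↔ k = 0 := by
      rw [cubes, mem_preimage, cubeIndex_latticePoint (pos_iff_ne_zero.2 hδ), mem_singleton_iff]
    rw [cubeSide, if_neg hδ, lam_apply_of_ne_zero hδ (measurableSet_cubes _ _), tsum_eq_single 0
      fun k hk => indicator_of_notMem (mt (hmem k).1 hk) _, indicator_of_mem ((hmem 0).2 rfl)]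
    simp

end Lam

lemma volume_pos_of_mem_nhdsWithin_Ici {ι : Type*} [Fintype ι] {t : ι → ℝ} {A : Set (ι → ℝ)}
    (hA : A ∈ 𝓝[Ici t] t) : 0 < volume A := by
  obtain ⟨ε, hε, hsub⟩ := Metric.mem_nhdsWithin_iff.1 hA
  have hcube : Set.pi univ (fun i => Ioo (t i) (t i + ε)) ⊆ A := by
    intro s hs
    simp only [Set.mem_pi, mem_univ, mem_Ioo, forall_const] at hs
    refine hsub ⟨?_, fun i => (hs i).1.le⟩
    rw [Metric.mem_ball, dist_pi_lt_iff hε]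
    intro i
    rw [Real.dist_eq, abs_lt]
    constructor <;> linarith [(hs i).1, (hs i).2]
  refine lt_of_lt_of_le ?_ (measure_mono hcube)
  rw [volume_pi_pi, pos_iff_ne_zero]
  exact Finset.prod_ne_zero_iff.2 fun i _ => by simp [hε]

namespace CadlagPath

variable {d : ℕ}

section TotalMass

variable {δ : ℝ≥0}

lemma measurable_totalMass (δ : ℝ≥0) : Measurable fun f : CadlagPath d => totalMass δ f.1 :=
  Measurable.lintegral_prod_right' (f := fun p : CadlagPath d × (Fin d → ℝ) => (p.1.1 p.2 : ℝ≥0∞))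
    measurable_eval.coe_nnreal_ennreal

lemma isHomogeneous_totalMass (δ : ℝ≥0) :
    IsHomogeneous fun f : CadlagPath d => totalMass δ f.1 := fun c f _ => by
  simp only [totalMass, scale_apply, ENNReal.coe_mul]
  exact lintegral_const_mul' _ _ ENNReal.coe_ne_top

lemma totalMass_shift {τ : Fin d → ℝ} (hτ : IsLamShift d δ τ) (f : CadlagPath d) :
    totalMass δ (shift τ f).1 = totalMass δ f.1 :=
  hτ.lintegral_comp (measurable_coe f).coe_nnreal_ennreal

lemma totalMass_zero_pos {f : CadlagPath d} (h : ∃ t, 0 < f.1 t) : 0 < totalMass 0 f.1 := by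
  obtain ⟨t, ht⟩ := h
  have hsupport : 0 < volume {s | 0 < f.1 s} :=
    volume_pos_of_mem_nhdsWithin_Ici ((f.2 t).2.eventually (lt_mem_nhds ht))
  rw [totalMass, lam_zero, lintegral_pos_iff_support (measurable_coe f).coe_nnreal_ennreal]
  convert hsupport using 2
  ext s
  simp [pos_iff_ne_zero]

end TotalMass

/-- The functional `∫_0^∞ 𝟙(∫_{K ∩ δ ℤᵈ} 𝟙(f(t) > s) λ_δ(dt) > x) ds`, whose mean is the Berman
functional over `K`. -/
noncomputable def excess (δ : ℝ≥0) (K : Set (Fin d → ℝ)) (x : ℝ≥0) (f : CadlagPath d) : ℝ≥0∞ :=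
  volume {s : ℝ | 0 < s ∧ (x : ℝ≥0∞) < sojourn δ K s f.1}

section Excess

variable {δ x : ℝ≥0} {K : Set (Fin d → ℝ)}

lemma measurableSet_lt_sojourn (hK : MeasurableSet K) :
    MeasurableSet {p : CadlagPath d × ℝ | 0 < p.2 ∧ (x : ℝ≥0∞) < sojourn δ K p.2 p.1.1} := by
  have hA : MeasurableSet
      {q : (CadlagPath d × ℝ) × (Fin d → ℝ) | q.2 ∈ K ∧ q.1.2 < (q.1.1.1 q.2 : ℝ)} :=
    (measurable_snd hK).inter (measurableSet_lt (by fun_prop) (measurable_eval.comp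
      ((measurable_fst.comp measurable_fst).prodMk measurable_snd)).coe_nnreal_real)
  exact (measurableSet_lt measurable_const measurable_snd).inter
    (measurableSet_lt measurable_const (measurable_measure_prodMk_left (ν := lam d δ) hA))

lemma measurable_excess (δ : ℝ≥0) (hK : MeasurableSet K) (x : ℝ≥0) : Measurable (excess δ K x) :=
  measurable_measure_prodMk_left (ν := volume) (measurableSet_lt_sojourn hK)

lemma sojourn_scale (δ : ℝ≥0) (K : Set (Fin d → ℝ)) (s : ℝ) {c : ℝ≥0} (hc : 0 < c)
    (f : CadlagPath d) : sojourn δ K (c * s) (scale c f).1 = sojourn δ K s f.1 := by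
  have : (0 : ℝ) < c := by exact_mod_cast hc
  simp [sojourn, this]

lemma isHomogeneous_excess (δ : ℝ≥0) (K : Set (Fin d → ℝ)) (x : ℝ≥0) :
    IsHomogeneous (excess δ K x) := by
  intro c f hc
  have hc' : (0 : ℝ) < c := by exact_mod_cast hc
  have hsmul := Measure.addHaar_smul (volume : Measure ℝ) (c : ℝ)
    {s : ℝ | 0 < s ∧ (x : ℝ≥0∞) < sojourn δ K s f.1}
  rw [Module.finrank_self, pow_one, abs_of_pos hc', ENNReal.ofReal_coe_nnreal] at hsmul
  rw [excess, excess, ← hsmul]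
  congr 1
  ext s
  rw [mem_smul_set_iff_inv_smul_mem₀ hc'.ne', smul_eq_mul]
  simp only [mem_ofPred_eq]
  rw [← sojourn_scale δ K ((c : ℝ)⁻¹ * s) hc, mul_inv_cancel_left₀ hc'.ne',
    mul_pos_iff_of_pos_left (inv_pos.2 hc')]

lemma excess_shift {τ : Fin d → ℝ} (hτ : IsLamShift d δ τ) (hK : MeasurableSet K) (x : ℝ≥0)
    (f : CadlagPath d) : excess δ ((fun t => t + τ) ⁻¹' K) x (shift τ f) = excess δ K x f := by
  have hsojourn (s : ℝ) :
      sojourn δ ((fun t => t + τ) ⁻¹' K) s (shift τ f).1 = sojourn δ K s f.1 :=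
    hτ.measure_preimage (hK.inter (measurableSet_lt measurable_const
      (measurable_coe f).coe_nnreal_real)).nullMeasurableSet
  simp only [excess, hsojourn]

lemma sojourn_mono (δ : ℝ≥0) {K L : Set (Fin d → ℝ)} (h : K ⊆ L) (s : ℝ) (f : FieldPath d) :
    sojourn δ K s f ≤ sojourn δ L s f :=
  measure_mono fun _ ht => ⟨h ht.1, ht.2⟩

lemma excess_mono (δ : ℝ≥0) {K L : Set (Fin d → ℝ)} (h : K ⊆ L) (x : ℝ≥0) (f : CadlagPath d) :
    excess δ K x f ≤ excess δ L x f :=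
  measure_mono fun s hs => ⟨hs.1, hs.2.trans_le (sojourn_mono δ h s f.1)⟩

lemma sojourn_iUnion (δ : ℝ≥0) {K : ℕ → Set (Fin d → ℝ)} (hK : Monotone K) (s : ℝ)
    (f : FieldPath d) : sojourn δ (⋃ n, K n) s f = ⨆ n, sojourn δ (K n) s f := by
  have hunion : {t | t ∈ ⋃ n, K n ∧ s < (f t : ℝ)} = ⋃ n, {t | t ∈ K n ∧ s < (f t : ℝ)} := by
    ext t
    simp
  have hmono : Monotone fun n => {t | t ∈ K n ∧ s < (f t : ℝ)} :=
    fun m n hmn t ht => ⟨hK hmn ht.1, ht.2⟩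
  rw [sojourn, hunion, hmono.measure_iUnion]
  rfl

lemma excess_iUnion (δ : ℝ≥0) {K : ℕ → Set (Fin d → ℝ)} (hK : Monotone K) (x : ℝ≥0)
    (f : CadlagPath d) : excess δ (⋃ n, K n) x f = ⨆ n, excess δ (K n) x f := by
  have hunion : {s : ℝ | 0 < s ∧ (x : ℝ≥0∞) < sojourn δ (⋃ n, K n) s f.1} =
      ⋃ n, {s : ℝ | 0 < s ∧ (x : ℝ≥0∞) < sojourn δ (K n) s f.1} := by
    ext s
    simp [sojourn_iUnion δ hK, lt_iSup_iff]
  have hmono : Monotone fun n => {s : ℝ | 0 < s ∧ (x : ℝ≥0∞) < sojourn δ (K n) s f.1} :=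
    fun m n hmn s hs => ⟨hs.1, hs.2.trans_le (sojourn_mono δ (hK hmn) s f.1)⟩
  rw [excess, hunion, hmono.measure_iUnion]
  rfl

lemma excess_le_of_forall_le {f : CadlagPath d} {m : ℝ≥0∞} (h : ∀ t ∈ K, (f.1 t : ℝ≥0∞) ≤ m) :
    excess δ K x f ≤ m := by
  rcases eq_or_ne m ∞ with rfl | hm
  · exact le_top
  lift m to ℝ≥0 using hm
  have hempty {s : ℝ} (hs : (m : ℝ) ≤ s) : {t | t ∈ K ∧ s < (f.1 t : ℝ)} = ∅ := by
    refine eq_empty_of_forall_notMem fun t ht => ht.2.not_ge (le_trans ?_ hs)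
    exact_mod_cast h t ht.1
  calc excess δ K x f ≤ volume (Ioo (0 : ℝ) m) := by
        refine measure_mono fun s hs => ⟨hs.1, not_le.1 fun hms => ?_⟩
        have hx := hs.2
        rw [sojourn, hempty hms, measure_empty] at hx
        exact not_lt_zero hx
    _ = m := by rw [Real.volume_Ioo, sub_zero, ENNReal.ofReal_coe_nnreal]

lemma excess_eq_zero_of_totalMass_eq_zero {f : CadlagPath d} (h : totalMass δ f.1 = 0) :
    excess δ K x f = 0 := by
  rw [totalMass, lintegral_eq_zero_iff (measurable_coe f).coe_nnreal_ennreal] at h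
  have hsojourn {s : ℝ} (hs : 0 < s) : sojourn δ K s f.1 = 0 := by
    refine measure_mono_null (fun t ht => ?_) (ae_iff.1 h)
    have hpos : (0 : ℝ) < f.1 t := hs.trans ht.2
    simpa using hpos.ne'
  have hempty : {s : ℝ | 0 < s ∧ (x : ℝ≥0∞) < sojourn δ K s f.1} = ∅ :=
    eq_empty_of_forall_notMem fun s hs => not_lt_zero (hsojourn hs.1 ▸ hs.2)
  rw [excess, hempty, measure_empty]

lemma bermanOn_eq_lintegral_excess {Ω : Type*} [MeasurableSpace Ω] {P : Measure Ω} [SFinite P]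
    {W : Ω → FieldPath d} {Y : Ω → CadlagPath d} (hY : IsCadlagModification P W Y)
    (δ x : ℝ≥0) (hK : MeasurableSet K) :
    bermanOn P W δ K x = ∫⁻ ω, excess δ K x (Y ω) ∂P := by
  have hset : MeasurableSet {p : Ω × ℝ | 0 < p.2 ∧ (x : ℝ≥0∞) < sojourn δ K p.2 (Y p.1).1} :=
    ((hY.measurable.comp measurable_fst).prodMk measurable_snd) (measurableSet_lt_sojourn hK)
  have hfubini := Measure.prod_apply (μ := P) (ν := (volume : Measure ℝ)) hset
  rw [Measure.prod_apply_symm hset] at hfubini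
  refine Eq.trans ?_ hfubini
  rw [bermanOn, ← lintegral_indicator measurableSet_Ioi]
  refine lintegral_congr fun s => ?_
  by_cases hs : 0 < s
  · rw [indicator_of_mem (show s ∈ Ioi 0 from hs)]
    refine measure_congr ?_
    filter_upwards [hY.ae_eq] with ω hω
    refine propext ?_
    change (x : ℝ≥0∞) < sojourn δ K s (W ω) ↔ 0 < s ∧ (x : ℝ≥0∞) < sojourn δ K s (Y ω).1
    rw [hω, and_iff_right hs]
  · have hempty : (fun ω => (ω, s)) ⁻¹'
        {p : Ω × ℝ | 0 < p.2 ∧ (x : ℝ≥0∞) < sojourn δ K p.2 (Y p.1).1} = ∅ :=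
      eq_empty_of_forall_notMem fun ω hω => hs hω.1
    rw [indicator_of_notMem (show s ∉ Ioi 0 from hs), hempty, measure_empty]

end Excess

end CadlagPath

/-! ### Averages over boxes of lattice points -/

/-- The lattice box `{0, …, n - 1}ᵈ`. -/
noncomputable def latticeBox (d n : ℕ) : Finset (Fin d → ℤ) :=
  Fintype.piFinset fun _ => Finset.Ico 0 (n : ℤ)

/-- The points of `{0, …, n - 1}ᵈ` at distance at least `√n` from its boundary. -/
noncomputable def latticeInterior (d n : ℕ) : Finset (Fin d → ℤ) :=
  Fintype.piFinset fun _ => Finset.Ico (n.sqrt : ℤ) (n - n.sqrt)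

/-- The lattice window `{-m, …, m}ᵈ`. -/
def latticeWindow (d m : ℕ) : Set (Fin d → ℤ) := {k | ∀ i, -(m : ℤ) ≤ k i ∧ k i ≤ m}

section LatticeAverage

variable {d : ℕ}

lemma mem_latticeBox {n : ℕ} {k : Fin d → ℤ} : k ∈ latticeBox d n ↔ ∀ i, 0 ≤ k i ∧ k i < n := by
  simp [latticeBox]

lemma card_latticeBox (d n : ℕ) : (latticeBox d n).card = n ^ d := by
  simp [latticeBox]

lemma mem_latticeInterior {n : ℕ} {k : Fin d → ℤ} :
    k ∈ latticeInterior d n ↔ ∀ i, (n.sqrt : ℤ) ≤ k i ∧ k i < n - n.sqrt := by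
  simp [latticeInterior]

lemma card_latticeInterior (d n : ℕ) : (latticeInterior d n).card = (n - 2 * n.sqrt) ^ d := by
  rw [latticeInterior, Fintype.card_piFinset]
  simp only [Int.card_Ico, Finset.prod_const, Finset.card_univ, Fintype.card_fin]
  congr 1
  omega

lemma latticeInterior_subset (d n : ℕ) : latticeInterior d n ⊆ latticeBox d n := fun k hk =>
  mem_latticeBox.2 fun i => by have := mem_latticeInterior.1 hk i; omega

lemma latticeWindow_sqrt_subset {n : ℕ} {j : Fin d → ℤ} (hj : j ∈ latticeInterior d n) :
    latticeWindow d n.sqrt ⊆ {k | k + j ∈ latticeBox d n} := by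
  refine fun k hk => mem_latticeBox.2 fun i => ?_
  have hki := hk i
  have hji := mem_latticeInterior.1 hj i
  rw [Pi.add_apply]
  omega

lemma tendsto_natSqrt_atTop : Tendsto Nat.sqrt atTop atTop :=
  tendsto_atTop_atTop.2 fun m => ⟨m * m, fun _ hn => Nat.le_sqrt.2 hn⟩

lemma tendsto_natSqrt_div_atTop :
    Tendsto (fun n : ℕ => (n.sqrt : ℝ≥0∞) / n) atTop (𝓝 0) := by
  refine tendsto_of_tendsto_of_tendsto_of_le_of_le' tendsto_const_nhds
    (ENNReal.tendsto_inv_nat_nhds_zero.comp tendsto_natSqrt_atTop)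
    (Eventually.of_forall fun _ => zero_le) ?_
  filter_upwards [eventually_gt_atTop 0] with n hn
  have hsqrt : (n.sqrt : ℝ≥0∞) ≠ 0 := by exact_mod_cast (Nat.sqrt_pos.2 hn).ne'
  refine ENNReal.div_le_of_le_mul ?_
  calc (n.sqrt : ℝ≥0∞) = (n.sqrt : ℝ≥0∞)⁻¹ * (n.sqrt * n.sqrt) := by
        rw [← mul_assoc, ENNReal.inv_mul_cancel hsqrt (ENNReal.natCast_ne_top _), one_mul]
    _ ≤ (n.sqrt : ℝ≥0∞)⁻¹ * n := by
        gcongr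
        exact_mod_cast Nat.sqrt_le n

lemma tendsto_card_latticeInterior_div (d : ℕ) :
    Tendsto (fun n : ℕ => ((latticeInterior d n).card : ℝ≥0∞) / (n : ℝ≥0∞) ^ d) atTop (𝓝 1) := by
  have hside : Tendsto (fun n : ℕ => 1 - 2 * ((n.sqrt : ℝ≥0∞) / n)) atTop (𝓝 1) := by
    simpa using ENNReal.Tendsto.sub tendsto_const_nhds
      (ENNReal.Tendsto.const_mul tendsto_natSqrt_div_atTop (Or.inr ENNReal.ofNat_ne_top))
      (Or.inl ENNReal.one_ne_top)
  have hpow : Tendsto (fun n : ℕ => (1 - 2 * ((n.sqrt : ℝ≥0∞) / n)) ^ d) atTop (𝓝 1) := by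
    simpa [Function.comp_def] using ((ENNReal.continuous_pow d).tendsto 1).comp hside
  refine hpow.congr' ?_
  filter_upwards [eventually_gt_atTop 0] with n hn
  have hn0 : (n : ℝ≥0∞) ≠ 0 := by exact_mod_cast hn.ne'
  rw [card_latticeInterior, Nat.cast_pow, ENNReal.natCast_sub, ← mul_div_assoc,
    ← ENNReal.div_self hn0 (ENNReal.natCast_ne_top n), ← ENNReal.sub_div fun _ _ => hn0,
    ENNReal.div_eq_inv_mul, mul_pow, ← ENNReal.inv_pow, ← ENNReal.div_eq_inv_mul]
  push_cast
  rfl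

lemma card_latticeInterior_mul_le_sum {φ : Set (Fin d → ℤ) → ℝ≥0∞} {l : ℕ → ℝ≥0∞}
    (hl : ∀ m J, latticeWindow d m ⊆ J → l m ≤ φ J) (n : ℕ) :
    (latticeInterior d n).card * l n.sqrt ≤
      ∑ j ∈ latticeBox d n, φ {k | k + j ∈ latticeBox d n} :=
  calc ((latticeInterior d n).card : ℝ≥0∞) * l n.sqrt
      = ∑ _j ∈ latticeInterior d n, l n.sqrt := by rw [Finset.sum_const, nsmul_eq_mul]
    _ ≤ ∑ j ∈ latticeInterior d n, φ {k | k + j ∈ latticeBox d n} :=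
        Finset.sum_le_sum fun _ hj => hl _ _ (latticeWindow_sqrt_subset hj)
    _ ≤ _ := Finset.sum_le_sum_of_subset (latticeInterior_subset d n)

lemma sum_le_of_latticeWindow_subset {φ : Set (Fin d → ℤ) → ℝ≥0∞} {u : ℕ → ℝ≥0∞} {e : ℝ≥0∞}
    (hφe : ∀ J, 0 ∈ J → φ J ≤ e) (hu : ∀ m J, latticeWindow d m ⊆ J → φ J ≤ u m) (n : ℕ) :
    ∑ j ∈ latticeBox d n, φ {k | k + j ∈ latticeBox d n} ≤
      (n : ℝ≥0∞) ^ d * u n.sqrt + ((n : ℝ≥0∞) ^ d - (latticeInterior d n).card) * e := by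
  classical
  rw [← Finset.sum_sdiff (latticeInterior_subset d n), add_comm]
  have hinterior : ∑ j ∈ latticeInterior d n, φ {k | k + j ∈ latticeBox d n} ≤
      (n : ℝ≥0∞) ^ d * u n.sqrt := by
    refine (Finset.sum_le_sum fun _ hj => hu _ _ (latticeWindow_sqrt_subset hj)).trans ?_
    rw [Finset.sum_const, nsmul_eq_mul]
    gcongr
    exact_mod_cast card_latticeBox d n ▸ Finset.card_le_card (latticeInterior_subset d n)
  have hboundary : ∑ j ∈ latticeBox d n \ latticeInterior d n, φ {k | k + j ∈ latticeBox d n} ≤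
      ((n : ℝ≥0∞) ^ d - (latticeInterior d n).card) * e := by
    have hmem {j : Fin d → ℤ} (hj : j ∈ latticeBox d n \ latticeInterior d n) :
        (0 : Fin d → ℤ) ∈ {k | k + j ∈ latticeBox d n} := by
      simpa using (Finset.mem_sdiff.1 hj).1
    refine (Finset.sum_le_sum fun _ hj => hφe _ (hmem hj)).trans_eq ?_
    rw [Finset.sum_const, Finset.card_sdiff_of_subset (latticeInterior_subset d n),
      card_latticeBox, nsmul_eq_mul]
    push_cast
    rfl
  exact add_le_add hinterior hboundary

/- All but a vanishing proportion of the points of the box see the window of radius `√n`; at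
the remaining ones the crude bound `e` suffices. -/
lemma tendsto_average_latticeBox {φ : Set (Fin d → ℤ) → ℝ≥0∞} {l u : ℕ → ℝ≥0∞}
    {e β : ℝ≥0∞} (he : e ≠ ∞) (hφe : ∀ J, 0 ∈ J → φ J ≤ e)
    (hl : ∀ m J, latticeWindow d m ⊆ J → l m ≤ φ J)
    (hu : ∀ m J, latticeWindow d m ⊆ J → φ J ≤ u m)
    (hlβ : Tendsto l atTop (𝓝 β)) (huβ : Tendsto u atTop (𝓝 β)) :
    Tendsto (fun n : ℕ => (∑ j ∈ latticeBox d n, φ {k | k + j ∈ latticeBox d n}) /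
      (n : ℝ≥0∞) ^ d) atTop (𝓝 β) := by
  set r : ℕ → ℝ≥0∞ := fun n => (latticeInterior d n).card / (n : ℝ≥0∞) ^ d
  have hr : Tendsto r atTop (𝓝 1) := tendsto_card_latticeInterior_div d
  have hlower : Tendsto (fun n => r n * l n.sqrt) atTop (𝓝 β) := by
    simpa using ENNReal.Tendsto.mul hr (Or.inl one_ne_zero) (hlβ.comp tendsto_natSqrt_atTop)
      (Or.inr ENNReal.one_ne_top)
  have hupper : Tendsto (fun n => u n.sqrt + (1 - r n) * e) atTop (𝓝 β) := by
    have hboundary : Tendsto (fun n => 1 - r n) atTop (𝓝 0) := by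
      simpa using ENNReal.Tendsto.sub tendsto_const_nhds hr (Or.inl ENNReal.one_ne_top)
    simpa using (huβ.comp tendsto_natSqrt_atTop).add
      (ENNReal.Tendsto.mul_const hboundary (Or.inr he))
  refine tendsto_of_tendsto_of_tendsto_of_le_of_le' hlower hupper ?_ ?_
  · refine Eventually.of_forall fun n => ?_
    rw [← ENNReal.mul_div_right_comm]
    exact ENNReal.div_le_div_right (card_latticeInterior_mul_le_sum hl n) _
  · filter_upwards [eventually_gt_atTop 0] with n hn
    have hn0 : (n : ℝ≥0∞) ^ d ≠ 0 := pow_ne_zero _ (by exact_mod_cast hn.ne')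
    have hntop : (n : ℝ≥0∞) ^ d ≠ ∞ := ENNReal.pow_ne_top (ENNReal.natCast_ne_top n)
    refine (ENNReal.div_le_div_right (sum_le_of_latticeWindow_subset hφe hu n) _).trans_eq ?_
    rw [ENNReal.add_div, ENNReal.mul_div_right_comm, ENNReal.div_self hn0 hntop, one_mul,
      ENNReal.mul_div_right_comm, ENNReal.sub_div fun _ _ => hn0, ENNReal.div_self hn0 hntop]

end LatticeAverage

/-! ### The first cube in which a path is maximal -/

section LexMax

variable {ι κ : Type*} [LinearOrder κ]

lemma exists_isMax_lex (g : ι → ℝ≥0∞) (r : ι → κ) (s : Finset ι) (hs : s.Nonempty) :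
    ∃ j ∈ s, ∀ k ∈ s, g k < g j ∨ g k = g j ∧ r j ≤ r k := by
  obtain ⟨j, hj, hmax⟩ := s.exists_max_image (fun k => toLex (g k, OrderDual.toDual (r k))) hs
  refine ⟨j, hj, fun k hk => ?_⟩
  simpa [Prod.Lex.toLex_le_toLex] using hmax k hk

lemma exists_isMax_lex_of_tsum_ne_top (g : ι → ℝ≥0∞) (r : ι → κ) (hsum : ∑' k, g k ≠ ∞)
    (hpos : ∃ k, 0 < g k) : ∃ j, ∀ k, g k < g j ∨ g k = g j ∧ r j ≤ r k := by
  obtain ⟨k₀, hk₀⟩ := hpos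
  have hfin : {k | g k₀ ≤ g k}.Finite := ENNReal.finite_const_le_of_tsum_ne_top hsum hk₀.ne'
  obtain ⟨j, hj, hmax⟩ := exists_isMax_lex g r hfin.toFinset ⟨k₀, by simp⟩
  refine ⟨j, fun k => ?_⟩
  by_cases hk : g k₀ ≤ g k
  · exact hmax k (by simpa using hk)
  · exact Or.inl ((not_le.1 hk).trans_le (by simpa using hj))

end LexMax

namespace CadlagPath

variable {d : ℕ} {h : ℝ≥0} {J : Set (Fin d → ℤ)} {i j : Fin d → ℤ} {f : CadlagPath d}

/-- The supremum of a path over the points `h • (k + q)` of the cube with index `k`, where `q`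
has rational coordinates. For a càdlàg path this is the supremum over the whole cube; the
restriction to a countable set makes it measurable. -/
noncomputable def cubeSup (h : ℝ≥0) (k : Fin d → ℤ) (f : CadlagPath d) : ℝ≥0∞ :=
  ⨆ q : {q : Fin d → ℚ // ∀ i, 0 ≤ q i ∧ q i < 1},
    (f.1 (latticePoint h k + fun i => (h : ℝ) * (q.1 i : ℝ)) : ℝ≥0∞)

lemma measurable_cubeSup (h : ℝ≥0) (k : Fin d → ℤ) : Measurable (cubeSup h k) :=
  Measurable.iSup fun _ => (measurable_apply _).coe_nnreal_ennreal

lemma cubeSup_scale (h : ℝ≥0) (k : Fin d → ℤ) (c : ℝ≥0) (f : CadlagPath d) :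
    cubeSup h k (scale c f) = c * cubeSup h k f := by
  simp [cubeSup, ENNReal.mul_iSup]

lemma cubeSup_shift (h : ℝ≥0) (j k : Fin d → ℤ) (f : CadlagPath d) :
    cubeSup h k (shift (latticePoint h j) f) = cubeSup h (k + j) f := by
  simp only [cubeSup, shift_apply, latticePoint_add]
  exact iSup_congr fun q => by rw [add_right_comm]

lemma apply_smul_gridCeil_le_cubeSup (f : CadlagPath d) (t : Fin d → ℝ) {n : ℕ}
    (hn : ∀ i, gridCeil n ((h : ℝ)⁻¹ • t) i < ⌊t i / h⌋ + 1) :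
    (f.1 ((h : ℝ) • gridCeil n ((h : ℝ)⁻¹ • t)) : ℝ≥0∞) ≤ cubeSup h (cubeIndex h t) f := by
  set q : Fin d → ℚ := fun i => (⌈((n : ℝ) + 1) * (t i / h)⌉ : ℤ) / ((n : ℚ) + 1) - ⌊t i / h⌋
    with hq
  have hcast (i) : (q i : ℝ) = gridCeil n ((h : ℝ)⁻¹ • t) i - ⌊t i / h⌋ := by
    simp [hq, gridCeil, div_eq_inv_mul]
  refine le_iSup_of_le ⟨q, fun i => ⟨?_, ?_⟩⟩ (le_of_eq ?_)
  · have hle : t i / h ≤ gridCeil n ((h : ℝ)⁻¹ • t) i := by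
      simpa [div_eq_inv_mul] using le_gridCeil n ((h : ℝ)⁻¹ • t) i
    rw [← Rat.cast_nonneg (K := ℝ), hcast, sub_nonneg]
    exact (Int.floor_le _).trans hle
  · rw [← Rat.cast_lt (K := ℝ), hcast, Rat.cast_one]
    linarith [hn i]
  · refine congrArg (fun u => (f.1 u : ℝ≥0∞)) (funext fun i => ?_)
    simp only [Pi.add_apply, latticePoint, cubeIndex, hcast, Pi.smul_apply, smul_eq_mul]
    ring

lemma le_cubeSup (hh : 0 < h) (f : CadlagPath d) (t : Fin d → ℝ) :
    (f.1 t : ℝ≥0∞) ≤ cubeSup h (cubeIndex h t) f := by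
  have hh' : (0 : ℝ) < h := by exact_mod_cast hh
  set v : Fin d → ℝ := (h : ℝ)⁻¹ • t with hv
  have hvt : (h : ℝ) • v = t := by rw [hv, smul_smul, mul_inv_cancel₀ hh'.ne', one_smul]
  have hgrid := tendsto_nhdsWithin_iff.1 (tendsto_gridCeil v)
  have hsmul : Tendsto (fun n => (h : ℝ) • gridCeil n v) atTop (𝓝[Ici t] t) := by
    refine tendsto_nhdsWithin_iff.2 ⟨hvt ▸ hgrid.1.const_smul (h : ℝ),
      Eventually.of_forall fun n => ?_⟩
    exact hvt ▸ mem_Ici.2 (smul_le_smul_of_nonneg_left (le_gridCeil n v) hh'.le)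
  have hevent : ∀ᶠ n in atTop, ∀ i, gridCeil n v i < ⌊t i / h⌋ + 1 := by
    refine eventually_all.2 fun i => (tendsto_pi_nhds.1 hgrid.1 i).eventually (gt_mem_nhds ?_)
    rw [hv, Pi.smul_apply, smul_eq_mul, ← div_eq_inv_mul]
    exact Int.lt_floor_add_one _
  refine le_of_tendsto (ENNReal.tendsto_coe.2 ((f.2 t).2.tendsto.comp hsmul)) ?_
  filter_upwards [hevent] with n hn using apply_smul_gridCeil_le_cubeSup f t hn

/-- The cube with index `j` is the first one, in the lexicographic order, in which the path is
maximal among the cubes with indices in `J`. -/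
def firstMax (h : ℝ≥0) (J : Set (Fin d → ℤ)) (j : Fin d → ℤ) : Set (CadlagPath d) :=
  {f | ∀ k ∈ J, cubeSup h k f < cubeSup h j f ∨
    cubeSup h k f = cubeSup h j f ∧ toLex j ≤ toLex k}

lemma measurableSet_firstMax (h : ℝ≥0) (J : Set (Fin d → ℤ)) (j : Fin d → ℤ) :
    MeasurableSet (firstMax h J j) := by
  have hinter : firstMax h J j = ⋂ k ∈ J, ({f | cubeSup h k f < cubeSup h j f} ∪
      ({f | cubeSup h k f = cubeSup h j f} ∩ {_f | toLex j ≤ toLex k})) := by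
    ext f
    simp [firstMax]
  rw [hinter]
  exact MeasurableSet.biInter (to_countable J) fun k _ =>
    (measurableSet_lt (measurable_cubeSup h k) (measurable_cubeSup h j)).union
      ((measurableSet_eq_fun (measurable_cubeSup h k) (measurable_cubeSup h j)).inter
        (MeasurableSet.const _))

lemma isScaleInvariant_firstMax (h : ℝ≥0) (J : Set (Fin d → ℤ)) (j : Fin d → ℤ) :
    IsScaleInvariant (firstMax h J j) := by
  intro c f hc
  have hc0 : (c : ℝ≥0∞) ≠ 0 := by exact_mod_cast hc.ne'
  simp only [firstMax, mem_ofPred_eq, cubeSup_scale,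
    ENNReal.mul_lt_mul_iff_right hc0 ENNReal.coe_ne_top,
    ENNReal.mul_right_inj hc0 ENNReal.coe_ne_top]

lemma shift_mem_firstMax :
    shift (latticePoint h i) f ∈ firstMax h {k | k + i ∈ J} j ↔ f ∈ firstMax h J (j + i) := by
  have hlex (k : Fin d → ℤ) : toLex (j + i) ≤ toLex (k + i) ↔ toLex j ≤ toLex k := by
    rw [toLex_add, toLex_add, add_le_add_iff_right]
  simp only [firstMax, mem_ofPred_eq, cubeSup_shift]
  refine ⟨fun hf k hk => ?_, fun hf k hk => ?_⟩
  · have hfk := hf (k - i) (by rwa [sub_add_cancel])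
    rwa [← hlex, sub_add_cancel] at hfk
  · rw [← hlex]
    exact hf (k + i) hk

lemma firstMax_unique (hi : i ∈ J) (hj : j ∈ J) (hfi : f ∈ firstMax h J i)
    (hfj : f ∈ firstMax h J j) : i = j := by
  have hsup : cubeSup h i f = cubeSup h j f :=
    le_antisymm ((hfj i hi).elim le_of_lt fun hij => hij.1.le)
      ((hfi j hj).elim le_of_lt fun hji => hji.1.le)
  have hij := (hfi j hj).resolve_left (hsup ▸ lt_irrefl _)
  have hji := (hfj i hi).resolve_left (hsup ▸ lt_irrefl _)
  exact toLex.injective (le_antisymm hij.2 hji.2)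

lemma firstMax_anti (h : ℝ≥0) {J L : Set (Fin d → ℤ)} (hJL : J ⊆ L) (j : Fin d → ℤ) :
    firstMax h L j ⊆ firstMax h J j := fun _ hf k hk => hf k (hJL hk)

end CadlagPath

/-! ### Asymptotics of the expected excess over large boxes -/

lemma cubes_univ (d : ℕ) (h : ℝ≥0) : cubes (d := d) h univ = univ := preimage_univ

lemma cubes_mono {d : ℕ} (h : ℝ≥0) : Monotone (cubes (d := d) h) := fun _ _ => preimage_mono

lemma latticeWindow_mono (d : ℕ) : Monotone (latticeWindow d) := fun m n hmn k hk i => by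
  have := hk i
  constructor <;> omega

lemma iUnion_latticeWindow (d : ℕ) : ⋃ m, latticeWindow d m = univ := by
  refine eq_univ_of_forall fun k => mem_iUnion.2 ⟨∑ i, (k i).natAbs, fun i => ?_⟩
  have hle : (k i).natAbs ≤ ∑ i, (k i).natAbs :=
    Finset.single_le_sum (f := fun i => (k i).natAbs) (fun _ _ => Nat.zero_le _) (Finset.mem_univ i)
  omega

lemma iUnion_cubes_latticeWindow (d : ℕ) (h : ℝ≥0) :
    ⋃ m, cubes h (latticeWindow d m) = univ := by
  rw [← cubes_univ d h, ← iUnion_latticeWindow d]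
  exact preimage_iUnion.symm

lemma mem_cubes_latticeBox {d n : ℕ} {h : ℝ≥0} (hh : 0 < h) {t : Fin d → ℝ} :
    t ∈ cubes h (latticeBox d n) ↔ ∀ i, 0 ≤ t i ∧ t i < n * h := by
  have hh' : (0 : ℝ) < h := by exact_mod_cast hh
  simp only [cubes, cubeIndex, mem_preimage, SetLike.mem_coe, mem_latticeBox, Int.floor_nonneg,
    Int.floor_lt, Int.cast_natCast, le_div_iff₀ hh', zero_mul, div_lt_iff₀ hh']

lemma cubes_latticeBox_subset_Icc {d : ℕ} {h : ℝ≥0} (hh : 0 < h) {T : ℝ} (hT : 0 ≤ T) :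
    cubes (d := d) h (latticeBox d ⌊(h : ℝ)⁻¹ * T⌋₊) ⊆ Icc 0 fun _ => T := by
  have hh' : (0 : ℝ) < h := by exact_mod_cast hh
  have hfloor : ⌊(h : ℝ)⁻¹ * T⌋₊ * (h : ℝ) ≤ T := by
    rw [← le_div_iff₀ hh', div_eq_inv_mul]
    exact Nat.floor_le (by positivity)
  intro t ht
  have hbox := (mem_cubes_latticeBox hh).1 ht
  exact ⟨fun i => (hbox i).1, fun i => (hbox i).2.le.trans hfloor⟩

lemma Icc_subset_cubes_latticeBox (d : ℕ) {h : ℝ≥0} (hh : 0 < h) (T : ℝ) :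
    Icc 0 (fun _ => T) ⊆ cubes (d := d) h (latticeBox d (⌊(h : ℝ)⁻¹ * T⌋₊ + 1)) := by
  have hh' : (0 : ℝ) < h := by exact_mod_cast hh
  have hfloor : T < (⌊(h : ℝ)⁻¹ * T⌋₊ + 1 : ℕ) * (h : ℝ) := by
    rw [← div_lt_iff₀ hh', div_eq_inv_mul]
    exact_mod_cast Nat.lt_floor_add_one _
  exact fun t ht => (mem_cubes_latticeBox hh).2 fun i => ⟨ht.1 i, (ht.2 i).trans_lt hfloor⟩

lemma tendsto_div_ofReal_pow {d : ℕ} {b : ℕ → ℝ≥0∞} {β : ℝ≥0∞} (hβ : β ≠ ∞)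
    (hb : Tendsto (fun n : ℕ => b n / (n : ℝ≥0∞) ^ d) atTop (𝓝 β)) {N : ℝ → ℕ}
    (hN : Tendsto N atTop atTop) {h : ℝ≥0} (hh : 0 < h)
    (hNT : Tendsto (fun T : ℝ => (N T : ℝ) / T) atTop (𝓝 (h : ℝ)⁻¹)) :
    Tendsto (fun T : ℝ => b (N T) / ENNReal.ofReal (T ^ d)) atTop (𝓝 (β / (h : ℝ≥0∞) ^ d)) := by
  have hh' : (0 : ℝ) < h := by exact_mod_cast hh
  have hpow : Tendsto (fun T : ℝ => ENNReal.ofReal (((N T : ℝ) / T) ^ d)) atTop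
      (𝓝 ((h : ℝ≥0∞) ^ d)⁻¹) := by
    have hlim := ENNReal.tendsto_ofReal (hNT.pow d)
    rwa [ENNReal.ofReal_pow (by positivity), ENNReal.ofReal_inv_of_pos hh',
      ENNReal.ofReal_coe_nnreal, ← ENNReal.inv_pow] at hlim
  have hmul := ENNReal.Tendsto.mul (hb.comp hN) (Or.inr (by simp [hh.ne'])) hpow (Or.inr hβ)
  rw [div_eq_mul_inv]
  refine hmul.congr' ?_
  filter_upwards [eventually_gt_atTop 0, hN.eventually (eventually_gt_atTop 0)] with T hT hNpos
  have hN0 : (N T : ℝ≥0∞) ^ d ≠ 0 := pow_ne_zero _ (by exact_mod_cast hNpos.ne')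
  have hNtop : (N T : ℝ≥0∞) ^ d ≠ ∞ := ENNReal.pow_ne_top (ENNReal.natCast_ne_top _)
  rw [Function.comp_apply, div_pow, ENNReal.ofReal_div_of_pos (by positivity),
    ENNReal.ofReal_pow (by positivity), ENNReal.ofReal_natCast, ← mul_div_assoc,
    ENNReal.div_mul_cancel hN0 hNtop]

namespace CadlagPath

variable {d : ℕ} {μ : Measure (CadlagPath d)} {h δ x : ℝ≥0} {G : Set (CadlagPath d)}
  {J : Set (Fin d → ℤ)} {j : Fin d → ℤ} {f : CadlagPath d}

/-- Sets of paths that are invariant under rescaling and under the translations of the lattice of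
cubes of side `h`; both the set of all paths and the set of paths of finite mass are of this
form. -/
structure IsInvariantSet (h : ℝ≥0) (G : Set (CadlagPath d)) : Prop where
  measurableSet : MeasurableSet G
  isScaleInvariant : IsScaleInvariant G
  shift_mem : ∀ k f, shift (latticePoint h k) f ∈ G ↔ f ∈ G

lemma isInvariantSet_univ (h : ℝ≥0) : IsInvariantSet h (univ : Set (CadlagPath d)) :=
  ⟨MeasurableSet.univ, fun _ _ _ => by simp, by simp⟩

lemma IsInvariantSet.measurableSet_inter_firstMax (hG : IsInvariantSet h G)
    (J : Set (Fin d → ℤ)) (j : Fin d → ℤ) : MeasurableSet (G ∩ firstMax h J j) :=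
  hG.measurableSet.inter (measurableSet_firstMax h J j)

lemma excess_cubes_le (hh : 0 < h) (δ x : ℝ≥0) (hf : f ∈ firstMax h J j) :
    excess δ (cubes h J) x f ≤ cubeSup h j f :=
  excess_le_of_forall_le fun t ht =>
    (le_cubeSup hh f t).trans ((hf _ ht).elim le_of_lt fun heq => heq.1.le)

/-- The expected excess over the cubes with indices in `J` on the part of `G` where the cube with
index `j` is the first maximal one among them. -/
noncomputable def firstMaxExcess (μ : Measure (CadlagPath d)) (δ x : ℝ≥0)
    (G : Set (CadlagPath d)) (J : Set (Fin d → ℤ)) (j : Fin d → ℤ) : ℝ≥0∞ :=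
  ∫⁻ f in G ∩ firstMax (cubeSide δ) J j, excess δ (cubes (cubeSide δ) J) x f ∂μ

lemma firstMaxExcess_le (μ : Measure (CadlagPath d)) (δ x : ℝ≥0) (G : Set (CadlagPath d))
    (J : Set (Fin d → ℤ)) (j : Fin d → ℤ) :
    firstMaxExcess μ δ x G J j ≤ ∫⁻ f, cubeSup (cubeSide δ) j f ∂μ :=
  (setLIntegral_mono (measurable_cubeSup _ _) fun _ hf =>
    excess_cubes_le (cubeSide_pos δ) δ x hf.2).trans (setLIntegral_le_lintegral _ _)

lemma firstMaxExcess_eq_zero_index (hμ : IsMaxInvariant μ) (x : ℝ≥0)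
    (hG : IsInvariantSet (cubeSide δ) G) (J : Set (Fin d → ℤ)) (j : Fin d → ℤ) :
    firstMaxExcess μ δ x G J j = firstMaxExcess μ δ x G {k | k + j ∈ J} 0 := by
  set h := cubeSide δ
  have hmeas (J : Set (Fin d → ℤ)) (i : Fin d → ℤ) := hG.measurableSet_inter_firstMax J i
  have hmem (f : CadlagPath d) : shift (latticePoint h j) f ∈ G ∩ firstMax h {k | k + j ∈ J} 0 ↔
      f ∈ G ∩ firstMax h J j := by
    rw [mem_inter_iff, hG.shift_mem, shift_mem_firstMax, zero_add, mem_inter_iff]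
  have hexcess (f : CadlagPath d) :
      excess δ (cubes h {k | k + j ∈ J}) x (shift (latticePoint h j) f) =
        excess δ (cubes h J) x f := by
    rw [← excess_shift (isLamShift_latticePoint_cubeSide δ j) (measurableSet_cubes _ J) x f]
    congr 1
    ext t
    simp only [cubes, mem_preimage, mem_ofPred_eq, cubeIndex_add_latticePoint (cubeSide_pos δ), h]
  have hshift := hμ.lintegral_shift
    ((measurable_excess δ (measurableSet_cubes h {k | k + j ∈ J}) x).indicator
      (hmeas {k | k + j ∈ J} 0))
    ((isHomogeneous_excess δ _ x).indicator fun c f hc =>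
      and_congr (hG.isScaleInvariant c f hc) (isScaleInvariant_firstMax _ _ _ c f hc))
    (latticePoint h j)
  rw [firstMaxExcess, firstMaxExcess, ← lintegral_indicator (hmeas _ _),
    ← lintegral_indicator (hmeas _ _), ← hshift]
  exact lintegral_congr fun f => indicator_eq_indicator (hmem f).symm (hexcess f).symm

lemma setLIntegral_excess_eq_sum_firstMaxExcess (μ : Measure (CadlagPath d)) (δ x : ℝ≥0)
    (hG : MeasurableSet G) {J : Finset (Fin d → ℤ)} (hJ : J.Nonempty) :
    ∫⁻ f in G, excess δ (cubes (cubeSide δ) J) x f ∂μ =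
      ∑ j ∈ J, firstMaxExcess μ δ x G J j := by
  have hunion : G = ⋃ j ∈ J, G ∩ firstMax (cubeSide δ) J j := by
    refine subset_antisymm (fun f hf => ?_) (iUnion₂_subset fun _ _ => inter_subset_left)
    obtain ⟨j, hj, hmax⟩ := exists_isMax_lex (fun k => cubeSup (cubeSide δ) k f) toLex J hJ
    exact mem_iUnion₂.2 ⟨j, hj, hf, hmax⟩
  have hdisj : (J : Set (Fin d → ℤ)).PairwiseDisjoint fun j => G ∩ firstMax (cubeSide δ) J j :=
    fun i hi j hj hij => disjoint_left.2 fun f hfi hfj => hij (firstMax_unique hi hj hfi.2 hfj.2)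
  conv_lhs => rw [hunion]
  exact lintegral_biUnion_finset hdisj (fun j _ => hG.inter (measurableSet_firstMax _ _ _)) _

lemma firstMax_iUnion (h : ℝ≥0) {ι : Type*} (J : ι → Set (Fin d → ℤ)) (j : Fin d → ℤ) :
    firstMax h (⋃ n, J n) j = ⋂ n, firstMax h (J n) j := by
  ext f
  simp only [firstMax, mem_ofPred_eq, mem_iInter, mem_iUnion, forall_exists_index]
  exact forall_comm

lemma tendsto_setLIntegral_excess_latticeWindow (μ : Measure (CadlagPath d)) (δ x : ℝ≥0)
    (G : Set (CadlagPath d)) :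
    Tendsto (fun m => ∫⁻ f in G ∩ firstMax (cubeSide δ) univ 0,
      excess δ (cubes (cubeSide δ) (latticeWindow d m)) x f ∂μ) atTop
      (𝓝 (firstMaxExcess μ δ x G univ 0)) := by
  have hmono : Monotone fun m => cubes (cubeSide δ) (latticeWindow d m) :=
    (cubes_mono _).comp (latticeWindow_mono d)
  refine lintegral_tendsto_of_tendsto_of_monotone
    (fun m => (measurable_excess δ (measurableSet_cubes _ _) x).aemeasurable)
    (Eventually.of_forall fun f m n hmn => excess_mono δ (hmono hmn) x f)
    (Eventually.of_forall fun f => ?_)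
  rw [cubes_univ, ← iUnion_cubes_latticeWindow d (cubeSide δ), excess_iUnion δ hmono]
  exact tendsto_atTop_iSup fun m n hmn => excess_mono δ (hmono hmn) x f

lemma tendsto_setLIntegral_min_excess_cubeSup (x : ℝ≥0)
    (hsup : ∫⁻ f, cubeSup (cubeSide δ) 0 f ∂μ ≠ ∞) (hG : IsInvariantSet (cubeSide δ) G) :
    Tendsto (fun m => ∫⁻ f in G ∩ firstMax (cubeSide δ) (latticeWindow d m) 0,
      min (excess δ univ x f) (cubeSup (cubeSide δ) 0 f) ∂μ) atTop
      (𝓝 (firstMaxExcess μ δ x G univ 0)) := by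
  set A : ℕ → Set (CadlagPath d) := fun m => G ∩ firstMax (cubeSide δ) (latticeWindow d m) 0
  set F : CadlagPath d → ℝ≥0∞ := fun f => min (excess δ univ x f) (cubeSup (cubeSide δ) 0 f)
  have hA (m : ℕ) : MeasurableSet (A m) := hG.measurableSet_inter_firstMax _ _
  have hAanti : Antitone A := fun m n hmn =>
    inter_subset_inter_right _ (firstMax_anti _ (latticeWindow_mono d hmn) 0)
  have hAinter : ⋂ m, A m = G ∩ firstMax (cubeSide δ) univ 0 := by
    rw [← inter_iInter, ← firstMax_iUnion, iUnion_latticeWindow]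
  have hlimit : ∫⁻ f in ⋂ m, A m, F f ∂μ = firstMaxExcess μ δ x G univ 0 := by
    rw [hAinter, firstMaxExcess, cubes_univ]
    refine setLIntegral_congr_fun (hG.measurableSet_inter_firstMax _ _) fun f hf => min_eq_left ?_
    simpa only [cubes_univ] using excess_cubes_le (cubeSide_pos δ) δ x hf.2
  have hfinite : μ.withDensity F (A 0) ≠ ∞ := by
    rw [withDensity_apply _ (hA 0)]
    exact ne_top_of_le_ne_top hsup ((setLIntegral_le_lintegral _ _).trans
      (lintegral_mono fun f => min_le_right _ _))
  have hlim := tendsto_measure_iInter_atTop (μ := μ.withDensity F)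
    (fun m => (hA m).nullMeasurableSet) hAanti ⟨0, hfinite⟩
  rw [withDensity_apply _ (MeasurableSet.iInter hA), hlimit] at hlim
  exact hlim.congr fun m => withDensity_apply _ (hA m)

/- The box splits according to its first maximal cube, and the expected excess on each piece only
depends on the box seen from that cube. -/
lemma tendsto_setLIntegral_excess_latticeBox (hμ : IsMaxInvariant μ) (x : ℝ≥0)
    (hsup : ∫⁻ f, cubeSup (cubeSide δ) 0 f ∂μ ≠ ∞) (hG : IsInvariantSet (cubeSide δ) G) :
    Tendsto (fun n : ℕ => (∫⁻ f in G, excess δ (cubes (cubeSide δ) (latticeBox d n)) x f ∂μ) /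
      (n : ℝ≥0∞) ^ d) atTop (𝓝 (firstMaxExcess μ δ x G univ 0)) := by
  have haverage := tendsto_average_latticeBox (φ := fun J => firstMaxExcess μ δ x G J 0) hsup
    (fun J _ => firstMaxExcess_le μ δ x G J 0) (fun m J hJ => ?lower) (fun m J hJ => ?upper)
    (tendsto_setLIntegral_excess_latticeWindow μ δ x G)
    (tendsto_setLIntegral_min_excess_cubeSup x hsup hG)
  case lower =>
    exact lintegral_mono' (Measure.restrict_mono
      (inter_subset_inter_right _ (firstMax_anti _ (subset_univ J) 0)) le_rfl)
      fun f => excess_mono δ (cubes_mono _ hJ) x f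
  case upper =>
    refine (setLIntegral_mono ((measurable_excess δ MeasurableSet.univ x).min
      (measurable_cubeSup _ 0)) fun f hf => ?_).trans
      (lintegral_mono_set (inter_subset_inter_right _ (firstMax_anti _ hJ 0)))
    exact le_min (excess_mono δ (subset_univ _) x f) (excess_cubes_le (cubeSide_pos δ) δ x hf.2)
  refine haverage.congr' ?_
  filter_upwards [eventually_gt_atTop 0] with n hn
  have hne : (latticeBox d n).Nonempty := ⟨0, mem_latticeBox.2 fun i => by simpa using hn⟩
  rw [setLIntegral_excess_eq_sum_firstMaxExcess μ δ x hG.measurableSet hne]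
  simp only [firstMaxExcess_eq_zero_index hμ x hG (latticeBox d n), SetLike.mem_coe]

theorem tendsto_setLIntegral_excess_Icc (hμ : IsMaxInvariant μ) (x : ℝ≥0)
    (hsup : ∫⁻ f, cubeSup (cubeSide δ) 0 f ∂μ ≠ ∞) (hG : IsInvariantSet (cubeSide δ) G) :
    Tendsto (fun T : ℝ => (∫⁻ f in G, excess δ (Icc 0 fun _ => T) x f ∂μ) /
      ENNReal.ofReal (T ^ d)) atTop
      (𝓝 (firstMaxExcess μ δ x G univ 0 / (cubeSide δ : ℝ≥0∞) ^ d)) := by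
  have hbox := tendsto_setLIntegral_excess_latticeBox hμ x hsup hG
  have htop : firstMaxExcess μ δ x G univ 0 ≠ ∞ :=
    ne_top_of_le_ne_top hsup (firstMaxExcess_le μ δ x G univ 0)
  set h := cubeSide δ
  have hh : 0 < h := cubeSide_pos δ
  have hinv : (0 : ℝ) < (h : ℝ)⁻¹ := by positivity
  have hfloor : Tendsto (fun T : ℝ => ⌊(h : ℝ)⁻¹ * T⌋₊) atTop atTop :=
    tendsto_nat_floor_atTop.comp (tendsto_id.const_mul_atTop hinv)
  have hratio : Tendsto (fun T : ℝ => (⌊(h : ℝ)⁻¹ * T⌋₊ : ℝ) / T) atTop (𝓝 (h : ℝ)⁻¹) :=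
    tendsto_nat_floor_mul_div_atTop hinv.le
  have hratio_succ : Tendsto (fun T : ℝ => ((⌊(h : ℝ)⁻¹ * T⌋₊ + 1 : ℕ) : ℝ) / T) atTop
      (𝓝 (h : ℝ)⁻¹) := by
    simpa [add_div] using hratio.add tendsto_inv_atTop_zero
  refine tendsto_of_tendsto_of_tendsto_of_le_of_le'
    (tendsto_div_ofReal_pow htop hbox hfloor hh hratio)
    (tendsto_div_ofReal_pow htop hbox ((tendsto_add_atTop_nat 1).comp hfloor) hh hratio_succ) ?_ ?_
  · filter_upwards [eventually_ge_atTop 0] with T hT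
    gcongr with f
    exact excess_mono δ (cubes_latticeBox_subset_Icc hh hT) x f
  · refine Eventually.of_forall fun T => ?_
    gcongr with f
    exact excess_mono δ (Icc_subset_cubes_latticeBox d hh T) x f

end CadlagPath

/-! ### Mass transport -/

namespace CadlagPath

variable {d : ℕ} {μ : Measure (CadlagPath d)} {h δ : ℝ≥0} {j : Fin d → ℤ} {f : CadlagPath d}

lemma IsMaxInvariant.mass_transport (hμ : IsMaxInvariant μ) (h : ℝ≥0)
    {a b : CadlagPath d → ℝ≥0∞} (ha : Measurable a) (hb : Measurable b) (hahom : IsHomogeneous a)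
    (hbscale : ∀ (c : ℝ≥0) f, 0 < c → b (scale c f) = b f) :
    ∫⁻ f, (∑' j, a (shift (latticePoint h j) f)) * b f ∂μ =
      ∫⁻ f, a f * ∑' j, b (shift (latticePoint h j) f) ∂μ := by
  have hmeasa (j : Fin d → ℤ) : Measurable fun f => a (shift (latticePoint h j) f) * b f :=
    (ha.comp (measurable_shift _)).mul hb
  have hmeasb (j : Fin d → ℤ) : Measurable fun f => a f * b (shift (latticePoint h j) f) :=
    ha.mul (hb.comp (measurable_shift _))
  simp_rw [← ENNReal.tsum_mul_right, ← ENNReal.tsum_mul_left]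
  rw [lintegral_tsum fun j => (hmeasa j).aemeasurable,
    lintegral_tsum fun j => (hmeasb j).aemeasurable, ← (Equiv.neg (Fin d → ℤ)).tsum_eq]
  refine tsum_congr fun j => ?_
  rw [← hμ.lintegral_shift (hmeasb j) (fun c f hc => by
    rw [hahom c f hc, shift_scale, hbscale c _ hc, mul_assoc]) (latticePoint h (-j))]
  refine lintegral_congr fun f => ?_
  rw [shift_shift, ← latticePoint_add, add_neg_cancel, latticePoint_zero, shift_zero,
    Equiv.neg_apply]

lemma isHomogeneous_cubeSup (h : ℝ≥0) (k : Fin d → ℤ) : IsHomogeneous (cubeSup h k) :=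
  fun c f _ => cubeSup_scale h k c f

lemma shift_mem_firstMax_univ :
    shift (latticePoint h j) f ∈ firstMax h univ 0 ↔ f ∈ firstMax h univ j := by
  simpa using shift_mem_firstMax (h := h) (J := univ) (i := j) (j := 0) (f := f)

lemma tsum_indicator_firstMax_shift {F : CadlagPath d → ℝ≥0∞}
    (hF : ∀ k f, F (shift (latticePoint h k) f) = F f) (hj : f ∈ firstMax h univ j) :
    ∑' k, (firstMax h univ 0).indicator F (shift (latticePoint h k) f) = F f := by
  rw [tsum_eq_single j, indicator_of_mem (shift_mem_firstMax_univ.2 hj), hF]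
  exact fun k hk => indicator_of_notMem (fun hk' => hk (firstMax_unique (mem_univ _) (mem_univ _)
    (shift_mem_firstMax_univ.1 hk') hj)) _

lemma tsum_indicator_firstMax_shift_le_one (h : ℝ≥0) (f : CadlagPath d) :
    ∑' k, (firstMax h univ 0).indicator (1 : CadlagPath d → ℝ≥0∞)
      (shift (latticePoint h k) f) ≤ 1 := by
  by_cases hf : ∃ j, f ∈ firstMax h univ j
  · obtain ⟨j, hj⟩ := hf
    exact (tsum_indicator_firstMax_shift (fun _ _ => rfl) hj).le
  · push Not at hf
    simp [indicator, shift_mem_firstMax_univ, hf]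

lemma ae_tsum_cubeSup_ne_top_of_ne_zero (hμ : IsMaxInvariant μ)
    (hsup : ∫⁻ f, cubeSup h 0 f ∂μ ≠ ∞) {b : CadlagPath d → ℝ≥0∞} (hb : Measurable b)
    (hbscale : ∀ (c : ℝ≥0) f, 0 < c → b (scale c f) = b f)
    (hbsum : ∀ f, ∑' k, b (shift (latticePoint h k) f) ≤ 1) :
    ∀ᵐ f ∂μ, b f ≠ 0 → ∑' k, cubeSup h k f ≠ ∞ := by
  have htransport := hμ.mass_transport h (measurable_cubeSup h 0) hb
    (isHomogeneous_cubeSup h 0) hbscale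
  simp only [cubeSup_shift, zero_add] at htransport
  have hfinite : ∫⁻ f, (∑' k, cubeSup h k f) * b f ∂μ ≠ ∞ := by
    rw [htransport]
    exact ne_top_of_le_ne_top hsup (lintegral_mono fun f => mul_le_of_le_one_right' (hbsum f))
  filter_upwards [ae_lt_top ((Measurable.tsum fun k => measurable_cubeSup h k).mul hb) hfinite]
    with f hf hbf htop
  rw [Pi.mul_apply, htop, ENNReal.top_mul hbf] at hf
  exact lt_irrefl _ hf

lemma ae_tsum_cubeSup_ne_top_of_firstMax (hμ : IsMaxInvariant μ)
    (hsup : ∫⁻ f, cubeSup h 0 f ∂μ ≠ ∞) :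
    ∀ᵐ f ∂μ, f ∈ firstMax h univ 0 → ∑' k, cubeSup h k f ≠ ∞ := by
  filter_upwards [ae_tsum_cubeSup_ne_top_of_ne_zero hμ hsup
    (measurable_one.indicator (measurableSet_firstMax h univ 0))
    (fun c f hc => indicator_eq_indicator (isScaleInvariant_firstMax h univ 0 c f hc) rfl)
    (tsum_indicator_firstMax_shift_le_one h)] with f hf hmem
  exact hf (by simp [hmem])

/-- The mass of the path on the cube with index `k`. -/
noncomputable def cubeMass (δ h : ℝ≥0) (k : Fin d → ℤ) (f : CadlagPath d) : ℝ≥0∞ :=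
  ∫⁻ t in cubes h {k}, f.1 t ∂(lam d δ)

lemma measurable_cubeMass (δ h : ℝ≥0) (k : Fin d → ℤ) : Measurable (cubeMass δ h k) :=
  Measurable.lintegral_prod_right' (f := fun p : CadlagPath d × (Fin d → ℝ) => (p.1.1 p.2 : ℝ≥0∞))
    measurable_eval.coe_nnreal_ennreal

lemma isHomogeneous_cubeMass (δ h : ℝ≥0) (k : Fin d → ℤ) : IsHomogeneous (cubeMass δ h k) :=
  fun c f _ => by
    simp only [cubeMass, scale_apply, ENNReal.coe_mul]
    exact lintegral_const_mul' _ _ ENNReal.coe_ne_top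

lemma cubeMass_shift (hh : 0 < h) (hj : IsLamShift d δ (latticePoint h j)) (k : Fin d → ℤ)
    (f : CadlagPath d) : cubeMass δ h k (shift (latticePoint h j) f) = cubeMass δ h (k + j) f := by
  rw [cubeMass, cubeMass, ← hj.setLIntegral_comp_preimage (measurableSet_cubes h {k + j})
    (measurable_coe f).coe_nnreal_ennreal]
  congr 2
  ext t
  simp [cubes, cubeIndex_add_latticePoint hh]

lemma tsum_cubeMass (δ h : ℝ≥0) (f : CadlagPath d) : ∑' k, cubeMass δ h k f = totalMass δ f.1 := by
  have hunion : ⋃ k : Fin d → ℤ, cubes h {k} = univ := by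
    ext t
    simp [cubes]
  simp only [cubeMass]
  rw [← lintegral_iUnion (fun k => measurableSet_cubes h {k})
    fun i j hij => (disjoint_singleton.2 hij).preimage _, hunion, Measure.restrict_univ, totalMass]

lemma tsum_cubeMass_shift (hh : 0 < h) (hδ : ∀ j, IsLamShift d δ (latticePoint h j))
    (k : Fin d → ℤ) (f : CadlagPath d) :
    ∑' j, cubeMass δ h k (shift (latticePoint h j) f) = totalMass δ f.1 := by
  simp only [cubeMass_shift hh (hδ _)]
  rw [← tsum_cubeMass δ h f]
  exact (Equiv.addLeft k).tsum_eq fun j => cubeMass δ h j f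

lemma cubeMass_le (hh : 0 < h) (δ : ℝ≥0) (k : Fin d → ℤ) (f : CadlagPath d) :
    cubeMass δ h k f ≤ cubeSup h k f * lam d δ (cubes h {k}) := by
  rw [← setLIntegral_const]
  refine setLIntegral_mono measurable_const fun t ht => ?_
  exact mem_singleton_iff.1 ht ▸ le_cubeSup hh f t

lemma totalMass_le (hh : 0 < h) (hδ : ∀ j, IsLamShift d δ (latticePoint h j))
    (f : CadlagPath d) : totalMass δ f.1 ≤ (∑' k, cubeSup h k f) * lam d δ (cubes h {0}) := by
  rw [← tsum_cubeMass_shift hh hδ 0 f, ← ENNReal.tsum_mul_right]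
  refine ENNReal.tsum_le_tsum fun k => (cubeMass_le hh δ 0 _).trans_eq ?_
  rw [cubeSup_shift, zero_add]

lemma volume_cube_ne_top (hh : 0 < h) : volume (cubes (d := d) h {0}) ≠ ∞ := by
  have hsub : cubes (d := d) h {0} ⊆ Icc 0 fun _ => (h : ℝ) := by
    have hzero : (0 : Fin d → ℤ) ∈ latticeBox d 1 := mem_latticeBox.2 (by simp)
    intro t ht
    have hbox := (mem_cubes_latticeBox hh).1 (cubes_mono h (singleton_subset_iff.2 hzero) ht)
    exact ⟨fun i => (hbox i).1, fun i => by simpa using (hbox i).2.le⟩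
  exact ne_top_of_le_ne_top isCompact_Icc.measure_lt_top.ne (measure_mono hsub)

lemma totalMass_zero_ne_top (hh : 0 < h) (hf : ∑' k, cubeSup h k f ≠ ∞) :
    totalMass 0 f.1 ≠ ∞ := by
  refine ne_top_of_le_ne_top (ENNReal.mul_ne_top hf ?_)
    (totalMass_le hh (fun j => isLamShift_zero _) f)
  rw [lam_zero]
  exact volume_cube_ne_top hh

lemma totalMass_ne_top (hf : ∑' k, cubeSup (cubeSide δ) k f ≠ ∞) : totalMass δ f.1 ≠ ∞ :=
  ne_top_of_le_ne_top (ENNReal.mul_ne_top hf (by simp [lam_cube]))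
    (totalMass_le (cubeSide_pos δ) (isLamShift_latticePoint_cubeSide δ) f)

/- The relative masses of the cubes sum to one, so they can be transported. -/
lemma ae_tsum_cubeSup_ne_top_of_totalMass (hμ : IsMaxInvariant μ) (hh : 0 < h)
    (hsup : ∫⁻ f, cubeSup h 0 f ∂μ ≠ ∞) :
    ∀ᵐ f ∂μ, totalMass 0 f.1 ≠ ∞ → ∑' k, cubeSup h k f ≠ ∞ := by
  have hcube (k : Fin d → ℤ) :
      ∀ᵐ f ∂μ, cubeMass 0 h k f / totalMass 0 f.1 ≠ 0 → ∑' i, cubeSup h i f ≠ ∞ := by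
    refine ae_tsum_cubeSup_ne_top_of_ne_zero hμ hsup
      ((measurable_cubeMass 0 h k).div (measurable_totalMass 0)) (fun c f hc => ?_) fun f => ?_
    · have hmass : totalMass 0 (scale c f).1 = c * totalMass 0 f.1 :=
        isHomogeneous_totalMass 0 c f hc
      rw [isHomogeneous_cubeMass 0 h k c f hc, hmass,
        ENNReal.mul_div_mul_left _ _ (by exact_mod_cast hc.ne') ENNReal.coe_ne_top]
    · simp only [totalMass_shift (isLamShift_zero _), div_eq_mul_inv]
      rw [ENNReal.tsum_mul_right, tsum_cubeMass_shift hh (fun j => isLamShift_zero _)]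
      exact ENNReal.div_self_le_one
  filter_upwards [ae_all_iff.2 hcube, hμ.nonzero] with f hf hne hfinite
  obtain ⟨k, hk⟩ : ∃ k, cubeMass 0 h k f ≠ 0 := by
    by_contra! hzero
    refine (totalMass_zero_pos hne).ne' ?_
    rw [← tsum_cubeMass 0 h f]
    simp [hzero]
  exact hf k (ENNReal.div_pos hk hfinite).ne'

lemma exists_mem_firstMax (hh : 0 < h) (hf : ∃ t, 0 < f.1 t)
    (hsum : ∑' k, cubeSup h k f ≠ ∞) : ∃ j, f ∈ firstMax h univ j := by
  obtain ⟨t, ht⟩ := hf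
  have hpos : ∃ k, 0 < cubeSup h k f :=
    ⟨_, lt_of_lt_of_le (by exact_mod_cast ht) (le_cubeSup hh f t)⟩
  obtain ⟨j, hj⟩ := exists_isMax_lex_of_tsum_ne_top (fun k => cubeSup h k f) toLex hsum hpos
  exact ⟨j, fun k _ => hj k⟩

section Invariant

variable {F : CadlagPath d → ℝ≥0∞}

lemma lintegral_cubeMass_mul [SFinite μ] (hμ : IsMaxInvariant μ) (hF : Measurable F)
    (hFscale : ∀ (c : ℝ≥0) f, 0 < c → F (scale c f) = F f)
    (hFshift : ∀ τ, IsLamShift d δ τ → ∀ f, F (shift τ f) = F f) :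
    ∫⁻ f, cubeMass δ (cubeSide δ) 0 f * F f ∂μ =
      (cubeSide δ : ℝ≥0∞) ^ d * ∫⁻ f, f.1 0 * F f ∂μ := by
  set C : Set (Fin d → ℝ) := cubes (cubeSide δ) {0} with hC
  have hmeas : Measurable fun f : CadlagPath d => (f.1 0 : ℝ≥0∞) * F f :=
    (measurable_apply 0).coe_nnreal_ennreal.mul hF
  have hshift {t : Fin d → ℝ} (ht : IsLamShift d δ t) :
      ∫⁻ f, f.1 t * F f ∂μ = ∫⁻ f, f.1 0 * F f ∂μ := by
    rw [← hμ.lintegral_shift hmeas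
      (fun c f hc => by rw [hFscale c f hc, scale_apply, ENNReal.coe_mul, mul_assoc]) t]
    simp only [hFshift t ht, shift_apply, zero_add]
  calc ∫⁻ f, cubeMass δ (cubeSide δ) 0 f * F f ∂μ
      = ∫⁻ f, ∫⁻ t in C, f.1 t * F f ∂(lam d δ) ∂μ := lintegral_congr fun f =>
        (lintegral_mul_const _ (measurable_coe f).coe_nnreal_ennreal).symm
    _ = ∫⁻ t in C, ∫⁻ f, f.1 t * F f ∂μ ∂(lam d δ) :=
        lintegral_lintegral_swap (measurable_eval.coe_nnreal_ennreal.mul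
          (hF.comp measurable_fst)).aemeasurable
    _ = ∫⁻ _ in C, ∫⁻ f, f.1 0 * F f ∂μ ∂(lam d δ) :=
        lintegral_congr_ae (ae_restrict_of_ae ((ae_isLamShift d δ).mono fun _ ht => hshift ht))
    _ = (cubeSide δ : ℝ≥0∞) ^ d * ∫⁻ f, f.1 0 * F f ∂μ := by
        rw [setLIntegral_const, hC, lam_cube, mul_comm]

lemma lintegral_cubeMass_mul_eq_setLIntegral_firstMax (hμ : IsMaxInvariant μ)
    (hsum : ∀ᵐ f ∂μ, ∑' k, cubeSup (cubeSide δ) k f ≠ ∞) (hF : Measurable F)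
    (hFscale : ∀ (c : ℝ≥0) f, 0 < c → F (scale c f) = F f)
    (hFshift : ∀ τ, IsLamShift d δ τ → ∀ f, F (shift τ f) = F f) :
    ∫⁻ f, cubeMass δ (cubeSide δ) 0 f * F f ∂μ =
      ∫⁻ f in firstMax (cubeSide δ) univ 0, totalMass δ f.1 * F f ∂μ := by
  set A : Set (CadlagPath d) := firstMax (cubeSide δ) univ 0
  have hA : MeasurableSet A := measurableSet_firstMax _ _ _
  have hlattice := isLamShift_latticePoint_cubeSide (d := d) δ
  calc ∫⁻ f, cubeMass δ (cubeSide δ) 0 f * F f ∂μ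
      = ∫⁻ f, cubeMass δ (cubeSide δ) 0 f *
          ∑' k, A.indicator F (shift (latticePoint (cubeSide δ) k) f) ∂μ := by
        refine lintegral_congr_ae ?_
        filter_upwards [hsum, hμ.nonzero] with f hf hne
        obtain ⟨j, hj⟩ := exists_mem_firstMax (cubeSide_pos δ) hne hf
        rw [tsum_indicator_firstMax_shift (fun k => hFshift _ (hlattice k)) hj]
    _ = ∫⁻ f, (∑' k, cubeMass δ (cubeSide δ) 0 (shift (latticePoint (cubeSide δ) k) f)) *
          A.indicator F f ∂μ :=
        (hμ.mass_transport _ (measurable_cubeMass _ _ 0) (hF.indicator hA)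
          (isHomogeneous_cubeMass _ _ 0) fun c f hc =>
            indicator_eq_indicator (isScaleInvariant_firstMax _ _ _ c f hc)
              (hFscale c f hc)).symm
    _ = ∫⁻ f in A, totalMass δ f.1 * F f ∂μ := by
        rw [← lintegral_indicator hA]
        refine lintegral_congr fun f => ?_
        rw [tsum_cubeMass_shift (cubeSide_pos δ) hlattice, indicator_mul_right]

end Invariant

/-- The path `f` divided by its total mass; since `∞.toNNReal = 0` and `0⁻¹ = 0`, this is the zero
path when the total mass is `∞`. -/
noncomputable def unitMass (δ : ℝ≥0) (f : CadlagPath d) : CadlagPath d :=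
  scale (totalMass δ f.1).toNNReal⁻¹ f

lemma measurable_unitMass (δ : ℝ≥0) : Measurable (unitMass (d := d) δ) :=
  measurable_scale_uncurry.comp
    ((measurable_totalMass δ).ennreal_toNNReal.inv.prodMk measurable_id)

lemma unitMass_scale (δ : ℝ≥0) {c : ℝ≥0} (hc : 0 < c) (f : CadlagPath d) :
    unitMass δ (scale c f) = unitMass δ f := by
  have hmass : totalMass δ (scale c f).1 = c * totalMass δ f.1 := isHomogeneous_totalMass δ c f hc
  refine Subtype.ext (funext fun t => ?_)
  simp only [unitMass, scale_apply, hmass, ENNReal.toNNReal_mul, ENNReal.toNNReal_coe, mul_inv_rev,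
    mul_assoc, inv_mul_cancel_left₀ hc.ne']

lemma unitMass_shift {τ : Fin d → ℝ} (hτ : IsLamShift d δ τ) (f : CadlagPath d) :
    unitMass δ (shift τ f) = shift τ (unitMass δ f) := by
  rw [unitMass, unitMass, totalMass_shift hτ, shift_scale]

/-- The excess over `ℝᵈ` of the path divided by its total mass, the functional of `Θ` whose mean is
the integral in part (i) of the theorem. -/
noncomputable def unitExcess (δ x : ℝ≥0) (f : CadlagPath d) : ℝ≥0∞ :=
  excess δ univ x (unitMass δ f)

lemma measurable_unitExcess (δ x : ℝ≥0) : Measurable (unitExcess (d := d) δ x) :=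
  (measurable_excess δ MeasurableSet.univ x).comp (measurable_unitMass δ)

lemma unitExcess_scale (δ x c : ℝ≥0) (f : CadlagPath d) (hc : 0 < c) :
    unitExcess δ x (scale c f) = unitExcess δ x f := by
  rw [unitExcess, unitExcess, unitMass_scale δ hc]

lemma unitExcess_shift {τ : Fin d → ℝ} (hτ : IsLamShift d δ τ) (x : ℝ≥0) (f : CadlagPath d) :
    unitExcess δ x (shift τ f) = unitExcess δ x f := by
  have hexcess := excess_shift hτ MeasurableSet.univ x (unitMass δ f)
  rw [preimage_univ] at hexcess
  rw [unitExcess, unitExcess, unitMass_shift hτ, hexcess]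

lemma totalMass_mul_unitExcess (x : ℝ≥0) (hf : totalMass δ f.1 ≠ ∞) :
    totalMass δ f.1 * unitExcess δ x f = excess δ univ x f := by
  rcases eq_or_ne (totalMass δ f.1) 0 with hzero | hzero
  · rw [hzero, zero_mul, excess_eq_zero_of_totalMass_eq_zero hzero]
  · have hpos : 0 < (totalMass δ f.1).toNNReal := ENNReal.toNNReal_pos hzero hf
    rw [unitExcess, unitMass, isHomogeneous_excess δ univ x _ f (inv_pos.2 hpos),
      ENNReal.coe_inv hpos.ne', ENNReal.coe_toNNReal hf, ENNReal.mul_inv_cancel_left hzero hf]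

theorem firstMaxExcess_univ_eq [SFinite μ] (hμ : IsMaxInvariant μ) (x : ℝ≥0)
    (hsum : ∀ᵐ f ∂μ, ∑' k, cubeSup (cubeSide δ) k f ≠ ∞) :
    firstMaxExcess μ δ x univ univ 0 =
      (cubeSide δ : ℝ≥0∞) ^ d * ∫⁻ f, f.1 0 * unitExcess δ x f ∂μ := by
  have hscale (c : ℝ≥0) (f : CadlagPath d) (hc : 0 < c) := unitExcess_scale δ x c f hc
  have hshift (τ : Fin d → ℝ) (hτ : IsLamShift d δ τ) := unitExcess_shift hτ x
  rw [firstMaxExcess, univ_inter, cubes_univ,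
    ← lintegral_cubeMass_mul hμ (measurable_unitExcess δ x) hscale hshift,
    lintegral_cubeMass_mul_eq_setLIntegral_firstMax hμ hsum (measurable_unitExcess δ x) hscale
      hshift]
  refine lintegral_congr_ae (ae_restrict_of_ae ?_)
  filter_upwards [hsum] with f hf
  exact (totalMass_mul_unitExcess x (totalMass_ne_top hf)).symm

/-- The paths with finite Lebesgue integral, that is, with `S_0 < ∞`. -/
def finiteMass (d : ℕ) : Set (CadlagPath d) := {f | totalMass 0 f.1 < ∞}

lemma isInvariantSet_finiteMass (d : ℕ) (h : ℝ≥0) : IsInvariantSet h (finiteMass d) where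
  measurableSet := measurableSet_lt (measurable_totalMass 0) measurable_const
  isScaleInvariant c f hc := by
    have hc0 : (c : ℝ≥0∞) ≠ 0 := by exact_mod_cast hc.ne'
    have hmass : totalMass 0 (scale c f).1 = c * totalMass 0 f.1 := isHomogeneous_totalMass 0 c f hc
    rw [finiteMass, mem_ofPred_eq, mem_ofPred_eq, hmass]
    simp [lt_top_iff_ne_top, ENNReal.mul_eq_top, hc0]
  shift_mem k f := by simp only [finiteMass, mem_ofPred_eq, totalMass_shift (isLamShift_zero _)]

lemma firstMaxExcess_finiteMass (hμ : IsMaxInvariant μ) (x : ℝ≥0)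
    (hsup : ∫⁻ f, cubeSup (cubeSide δ) 0 f ∂μ ≠ ∞) :
    firstMaxExcess μ δ x (finiteMass d) univ 0 = firstMaxExcess μ δ x univ univ 0 := by
  refine setLIntegral_congr ?_
  filter_upwards [ae_tsum_cubeSup_ne_top_of_firstMax hμ hsup] with f hf
  exact propext ⟨fun hm => ⟨mem_univ f, hm.2⟩,
    fun hm => ⟨(totalMass_zero_ne_top (cubeSide_pos δ) (hf hm.2)).lt_top, hm.2⟩⟩

lemma setLIntegral_finiteMass_ne_zero [SFinite μ] (hμ : IsMaxInvariant μ)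
    (hpos : μ (finiteMass d) ≠ 0) :
    ∫⁻ f in finiteMass d, f.1 0 ∂μ ≠ 0 := by
  have hG := isInvariantSet_finiteMass d 1
  intro hzero
  have happly (t : Fin d → ℝ) : ∫⁻ f in finiteMass d, f.1 t ∂μ = 0 := by
    rw [← hzero, ← lintegral_indicator hG.measurableSet, ← lintegral_indicator hG.measurableSet,
      ← hμ.lintegral_shift ((measurable_apply 0).coe_nnreal_ennreal.indicator hG.measurableSet)
        (IsHomogeneous.indicator (fun c f _ => by simp) hG.isScaleInvariant) t]
    refine lintegral_congr fun f => indicator_eq_indicator ?_ (by simp)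
    simp only [finiteMass, mem_ofPred_eq, totalMass_shift (isLamShift_zero _)]
  have hmass : ∫⁻ f in finiteMass d, totalMass 0 f.1 ∂μ = 0 := by
    simp only [totalMass]
    rw [lintegral_lintegral_swap measurable_eval.coe_nnreal_ennreal.aemeasurable]
    simp [happly]
  rw [lintegral_eq_zero_iff (measurable_totalMass 0)] at hmass
  refine hpos (Measure.restrict_eq_zero.1 (ae_eq_bot.1 (eventually_false_iff_eq_bot.1 ?_)))
  filter_upwards [hmass, ae_restrict_of_ae hμ.nonzero] with f hf hne
  exact (totalMass_zero_pos hne).ne' hf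

end CadlagPath

/-! ### Berman functions -/

namespace IsCadlagModification

open CadlagPath

variable {d : ℕ} {Ω : Type*} [MeasurableSpace Ω] {P Q : Measure Ω} {Z : Ω → FieldPath d}
  {Y : Ω → CadlagPath d}

lemma mono (hY : IsCadlagModification P Z Y) (hQ : Q ≪ P) :
    IsCadlagModification Q Z Y :=
  ⟨hY.measurable, hQ.ae_le hY.ae_eq⟩

lemma div_const (hY : IsCadlagModification P Z Y) (c : ℝ≥0) :
    IsCadlagModification P (fun ω t => Z ω t / c) (fun ω => scale c⁻¹ (Y ω)) where
  measurable := measurable_scale_uncurry.comp (measurable_const.prodMk hY.measurable)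
  ae_eq := by
    filter_upwards [hY.ae_eq] with ω hω
    ext t
    simp only [scale_apply, hω, div_eq_inv_mul]

lemma normalizedField (hY : IsCadlagModification P Z Y) (δ : ℝ≥0) :
    IsCadlagModification P (normalizedField δ Z) (fun ω => unitMass δ (Y ω)) where
  measurable := (measurable_unitMass δ).comp hY.measurable
  ae_eq := by
    filter_upwards [hY.ae_eq] with ω hω
    ext t
    simp only [unitMass, scale_apply, hω, _root_.normalizedField, div_eq_inv_mul]

lemma preimage_val_ae_eq (hY : IsCadlagModification P Z Y) (B : Set (FieldPath d)) :
    Y ⁻¹' (Subtype.val ⁻¹' B) =ᵐ[P] {ω | Z ω ∈ B} :=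
  EventuallyEq.preimage (f := fun ω => (Y ω).1) hY.ae_eq B

lemma map_preimage_val (hY : IsCadlagModification P Z Y) {B : Set (FieldPath d)}
    (hB : MeasurableSet (Subtype.val ⁻¹' B : Set (CadlagPath d))) :
    P.map Y (Subtype.val ⁻¹' B) = P {ω | Z ω ∈ B} := by
  rw [Measure.map_apply hY.measurable hB, measure_congr (hY.preimage_val_ae_eq B)]

lemma map_finiteMass (hY : IsCadlagModification P Z Y) :
    P.map Y (finiteMass d) = P {ω | totalMass 0 (Z ω) < ∞} :=
  hY.map_preimage_val (B := {f | totalMass 0 f < ∞}) (isInvariantSet_finiteMass d 1).measurableSet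

end IsCadlagModification

namespace CadlagPath

variable {d : ℕ} {Ω Ω₁ Ω₂ : Type*} [MeasurableSpace Ω] [MeasurableSpace Ω₁] [MeasurableSpace Ω₂]
  {P : Measure Ω} {P₁ : Measure Ω₁} {P₂ : Measure Ω₂} {Z : Ω → FieldPath d}
  {Y : Ω → CadlagPath d} {Θ : Ω₂ → FieldPath d} {Y₂ : Ω₂ → CadlagPath d} {δ h : ℝ≥0}

lemma measurableSet_exists_pos : MeasurableSet {f : CadlagPath d | ∃ t, 0 < f.1 t} := by
  have hrat : {f : CadlagPath d | ∃ t, 0 < f.1 t} =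
      ⋃ q : Fin d → ℚ, {f | 0 < f.1 (fun i => (q i : ℝ))} := by
    ext f
    simp only [mem_ofPred_eq, mem_iUnion]
    exact ⟨exists_rat_pos, fun ⟨q, hq⟩ => ⟨_, hq⟩⟩
  rw [hrat]
  exact MeasurableSet.iUnion fun q => measurableSet_lt measurable_const (measurable_apply _)

lemma isMaxInvariant_map [IsProbabilityMeasure P] [IsProbabilityMeasure P₁]
    (hZ : IsSpectralField P Z) {E : ℕ → Ω₁ → ℝ} {Zc : ℕ → Ω₁ → FieldPath d}
    (hX : IsDeHaanInput P Z P₁ E Zc) (hstat : IsStationaryField P₁ (deHaanField E Zc))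
    (hY : IsCadlagModification P Z Y) : IsMaxInvariant (P.map Y) where
  mean_one t := by
    rw [lintegral_map (measurable_apply t).coe_nnreal_ennreal hY.measurable, ← hZ.mean_one t]
    refine lintegral_congr_ae ?_
    filter_upwards [hY.ae_eq] with ω hω
    rw [hω]
  nonzero := by
    rw [ae_map_iff hY.measurable.aemeasurable measurableSet_exists_pos]
    filter_upwards [hY.ae_eq, hZ.nonzero] with ω hω hne
    rwa [hω]
  max_shift s τ := by
    have hmeas : Measurable fun f : CadlagPath d => weightedMax s f.1 :=
      (measurable_weightedMax s).comp measurable_subtype_coe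
    rw [lintegral_map (measurable_weightedMax_shift s τ).coe_nnreal_ennreal hY.measurable,
      lintegral_map hmeas.coe_nnreal_ennreal hY.measurable]
    calc ∫⁻ ω, (weightedMax s (shift τ (Y ω)).1 : ℝ≥0) ∂P
        = ∫⁻ ω, (weightedMax s (fun t => Z ω (t + τ)) : ℝ≥0) ∂P := by
          refine lintegral_congr_ae ?_
          filter_upwards [hY.ae_eq] with ω hω
          simp only [shift, hω]
      _ = ∫⁻ ω, (weightedMax s (Z ω) : ℝ≥0) ∂P :=
          hX.lintegral_weightedMax_shift hZ.measurable hstat s τ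
      _ = ∫⁻ ω, (weightedMax s (Y ω).1 : ℝ≥0) ∂P := by
          refine lintegral_congr_ae ?_
          filter_upwards [hY.ae_eq] with ω hω
          rw [hω]

lemma lintegral_cubeSup_ne_top (hZ : IsSpectralField P Z) (hY : IsCadlagModification P Z Y)
    (hh : 0 < h) : ∫⁻ f, cubeSup h 0 f ∂(P.map Y) ≠ ∞ := by
  rw [lintegral_map (measurable_cubeSup h 0) hY.measurable]
  refine ne_top_of_le_ne_top (hZ.sup_integrable h (by exact_mod_cast hh)).ne (lintegral_mono_ae ?_)
  filter_upwards [hY.ae_eq] with ω hω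
  refine iSup_le fun q => ?_
  rw [latticePoint_zero, zero_add, hω]
  have hq (i : Fin d) : (0 : ℝ) ≤ q.1 i ∧ (q.1 i : ℝ) ≤ 1 :=
    ⟨by exact_mod_cast (q.2 i).1, by exact_mod_cast (q.2 i).2.le⟩
  exact le_iSup₂ (f := fun (t : Fin d → ℝ) (_ : t ∈ Icc 0 fun _ => (h : ℝ)) => (Z ω t : ℝ≥0∞)) _
    ⟨fun i => mul_nonneg h.2 (hq i).1, fun i => mul_le_of_le_one_right h.2 (hq i).2⟩

lemma map_eq_tiltedLaw (hZ : Measurable Z) (hΘ : IsTiltedField P Z P₂ Θ)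
    (hY : IsCadlagModification P Z Y) (hY₂ : IsCadlagModification P₂ Θ Y₂) :
    P₂.map Y₂ = tiltedLaw (P.map Y) 0 0 := by
  refine Measure.ext fun A hA => ?_
  obtain ⟨B, hB, rfl⟩ := hA
  have hBval : MeasurableSet (Subtype.val ⁻¹' B : Set (CadlagPath d)) := measurable_subtype_coe hB
  have hBnorm := measurable_normalize 0 0 hBval
  have hBdiv : MeasurableSet {ω | (fun t => Z ω t / Z ω 0) ∈ B} := by
    have hdiv : Measurable fun ω t => Z ω t / Z ω 0 := measurable_pi_lambda _ fun t =>
      ((measurable_pi_apply t).comp hZ).div ((measurable_pi_apply 0).comp hZ)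
    exact hdiv hB
  rw [hY₂.map_preimage_val hBval, hΘ.law B hB, tiltedLaw_apply _ _ _ hBval,
    setLIntegral_map hBnorm (measurable_apply _).coe_nnreal_ennreal hY.measurable,
    ← lintegral_indicator hBdiv, ← lintegral_indicator (hY.measurable hBnorm)]
  refine lintegral_congr_ae ?_
  filter_upwards [hY.ae_eq] with ω hω
  refine indicator_eq_indicator ?_ (by rw [add_zero, hω])
  simp only [mem_preimage, mem_ofPred_eq, normalize, scale, shift_zero, add_zero, hω,
    div_eq_inv_mul]

lemma bermanRatio_eq [SFinite P] (hY : IsCadlagModification P Z Y) (δ x : ℝ≥0) (T : ℝ) :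
    bermanRatio P Z δ x T =
      (∫⁻ f, excess δ (Icc 0 fun _ => T) x f ∂(P.map Y)) / ENNReal.ofReal (T ^ d) := by
  rw [bermanRatio, bermanOn_eq_lintegral_excess hY δ x measurableSet_Icc,
    lintegral_map (measurable_excess δ measurableSet_Icc x) hY.measurable]

lemma tendsto_bermanRatio_firstMaxExcess [SFinite P] (hY : IsCadlagModification P Z Y)
    (hμ : IsMaxInvariant (P.map Y)) (x : ℝ≥0)
    (hsup : ∫⁻ f, cubeSup (cubeSide δ) 0 f ∂(P.map Y) ≠ ∞) :
    Tendsto (bermanRatio P Z δ x) atTop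
      (𝓝 (firstMaxExcess (P.map Y) δ x univ univ 0 / (cubeSide δ : ℝ≥0∞) ^ d)) := by
  refine (tendsto_setLIntegral_excess_Icc hμ x hsup (isInvariantSet_univ _)).congr fun T => ?_
  rw [bermanRatio_eq hY, Measure.restrict_univ]

lemma berman_eq_firstMaxExcess [SFinite P] (hY : IsCadlagModification P Z Y)
    (hμ : IsMaxInvariant (P.map Y)) (x : ℝ≥0)
    (hsup : ∫⁻ f, cubeSup (cubeSide δ) 0 f ∂(P.map Y) ≠ ∞) :
    berman P Z δ x = firstMaxExcess (P.map Y) δ x univ univ 0 / (cubeSide δ : ℝ≥0∞) ^ d :=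
  (tendsto_bermanRatio_firstMaxExcess hY hμ x hsup).limUnder_eq

theorem tendsto_bermanRatio [SFinite P] (hY : IsCadlagModification P Z Y)
    (hμ : IsMaxInvariant (P.map Y)) (x : ℝ≥0)
    (hsup : ∫⁻ f, cubeSup (cubeSide δ) 0 f ∂(P.map Y) ≠ ∞) :
    Tendsto (bermanRatio P Z δ x) atTop (𝓝 (berman P Z δ x)) := by
  rw [berman_eq_firstMaxExcess hY hμ x hsup]
  exact tendsto_bermanRatio_firstMaxExcess hY hμ x hsup

lemma cubeSide_pow_ne_zero (d : ℕ) (δ : ℝ≥0) : (cubeSide δ : ℝ≥0∞) ^ d ≠ 0 :=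
  pow_ne_zero _ (by exact_mod_cast (cubeSide_pos δ).ne')

theorem berman_lt_top [SFinite P] (hY : IsCadlagModification P Z Y)
    (hμ : IsMaxInvariant (P.map Y)) (x : ℝ≥0)
    (hsup : ∫⁻ f, cubeSup (cubeSide δ) 0 f ∂(P.map Y) ≠ ∞) :
    berman P Z δ x < ∞ := by
  rw [berman_eq_firstMaxExcess hY hμ x hsup]
  exact ENNReal.div_lt_top
    (ne_top_of_le_ne_top hsup (firstMaxExcess_le _ δ x univ univ 0)) (cubeSide_pow_ne_zero d δ)

lemma bermanOn_normalizedField [SFinite P₂] (hY₂ : IsCadlagModification P₂ Θ Y₂)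
    {μ : Measure (CadlagPath d)} (hlaw : P₂.map Y₂ = tiltedLaw μ 0 0) (δ x : ℝ≥0) :
    bermanOn P₂ (normalizedField δ Θ) δ univ x = ∫⁻ f, f.1 0 * unitExcess δ x f ∂μ := by
  have hmeas := measurable_unitExcess (d := d) δ x
  rw [bermanOn_eq_lintegral_excess (hY₂.normalizedField δ) δ x MeasurableSet.univ]
  change ∫⁻ ω, unitExcess δ x (Y₂ ω) ∂P₂ = _
  rw [← lintegral_map hmeas hY₂.measurable, hlaw, lintegral_tiltedLaw _ _ _ hmeas]
  refine lintegral_congr fun f => ?_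
  simp only [normalize, add_zero, shift_zero]
  rcases eq_zero_or_pos (f.1 0) with h0 | hpos
  · simp only [h0, ENNReal.coe_zero, zero_mul]
  · rw [unitExcess_scale δ x _ f (inv_pos.2 hpos)]

theorem berman_eq_bermanOn_normalizedField [SFinite P] [SFinite P₂]
    (hY : IsCadlagModification P Z Y) (hμ : IsMaxInvariant (P.map Y)) (x : ℝ≥0)
    (hsup : ∫⁻ f, cubeSup (cubeSide δ) 0 f ∂(P.map Y) ≠ ∞)
    (hY₂ : IsCadlagModification P₂ Θ Y₂) (hlaw : P₂.map Y₂ = tiltedLaw (P.map Y) 0 0)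
    (hfin : ∀ᵐ ω ∂P, totalMass 0 (Z ω) < ∞) :
    berman P Z δ x = bermanOn P₂ (normalizedField δ Θ) δ univ x := by
  have hmass : ∀ᵐ f ∂(P.map Y), f ∈ finiteMass d := by
    refine (ae_map_iff hY.measurable.aemeasurable
      (isInvariantSet_finiteMass d 1).measurableSet).2 ?_
    filter_upwards [hY.ae_eq, hfin] with ω hω hlt
    rwa [← hω] at hlt
  have hsum : ∀ᵐ f ∂(P.map Y), ∑' k, cubeSup (cubeSide δ) k f ≠ ∞ := by
    filter_upwards [ae_tsum_cubeSup_ne_top_of_totalMass hμ (cubeSide_pos δ) hsup, hmass]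
      with f hf hlt using hf hlt.ne
  rw [berman_eq_firstMaxExcess hY hμ x hsup, firstMaxExcess_univ_eq hμ x hsum,
    bermanOn_normalizedField hY₂ hlaw, mul_comm,
    ENNReal.mul_div_cancel_right (cubeSide_pow_ne_zero d δ) (ENNReal.pow_ne_top ENNReal.coe_ne_top)]

lemma lintegral_finiteMassCond (hY : IsCadlagModification P Z Y) {F : CadlagPath d → ℝ≥0∞}
    (hF : Measurable F) :
    ∫⁻ ω, F (Y ω) ∂(finiteMassCond P Z) =
      (P.map Y (finiteMass d))⁻¹ * ∫⁻ f in finiteMass d, F f ∂(P.map Y) := by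
  have hset : Y ⁻¹' finiteMass d =ᵐ[P] {ω | totalMass 0 (Z ω) < ∞} :=
    hY.preimage_val_ae_eq {f | totalMass 0 f < ∞}
  rw [finiteMassCond, ProbabilityTheory.cond, lintegral_smul_measure, hY.map_finiteMass,
    ← Measure.restrict_congr_set hset,
    setLIntegral_map (isInvariantSet_finiteMass d 1).measurableSet hF hY.measurable, smul_eq_mul]

lemma lintegral_finiteMassCond_apply_zero (hY : IsCadlagModification P Z Y) :
    ∫⁻ ω, (Z ω 0 : ℝ≥0∞) ∂(finiteMassCond P Z) =
      (P.map Y (finiteMass d))⁻¹ * ∫⁻ f in finiteMass d, f.1 0 ∂(P.map Y) := by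
  rw [← lintegral_finiteMassCond hY (measurable_apply 0).coe_nnreal_ennreal]
  refine lintegral_congr_ae ?_
  filter_upwards [(hY.mono cond_absolutelyContinuous).ae_eq] with ω hω
  rw [hω]

lemma setLIntegral_finiteMass_ne_top (hμ : IsMaxInvariant (P.map Y)) :
    ∫⁻ f in finiteMass d, f.1 0 ∂(P.map Y) ≠ ∞ :=
  ne_top_of_le_ne_top ENNReal.one_ne_top
    ((setLIntegral_le_lintegral _ _).trans (hμ.mean_one 0).le)

lemma bermanRatio_conditionedField [IsFiniteMeasure P] (hY : IsCadlagModification P Z Y)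
    (hμ : IsMaxInvariant (P.map Y)) (hpos : P.map Y (finiteMass d) ≠ 0) (δ x : ℝ≥0) (T : ℝ) :
    bermanRatio (finiteMassCond P Z) (conditionedField P Z) δ x T =
      (∫⁻ f in finiteMass d, f.1 0 ∂(P.map Y))⁻¹ *
        ((∫⁻ f in finiteMass d, excess δ (Icc 0 fun _ => T) x f ∂(P.map Y)) /
          ENNReal.ofReal (T ^ d)) := by
  have hcond := lintegral_finiteMassCond hY
    (measurable_excess δ (K := Icc 0 fun _ => T) measurableSet_Icc x)
  have hmean := lintegral_finiteMassCond_apply_zero hY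
  set p := P.map Y (finiteMass d)
  set q := ∫⁻ f in finiteMass d, f.1 0 ∂(P.map Y)
  have hptop : p ≠ ∞ := measure_ne_top _ _
  have hmean_ne_zero : p⁻¹ * q ≠ 0 :=
    mul_ne_zero (ENNReal.inv_ne_zero.2 hptop) (setLIntegral_finiteMass_ne_zero hμ hpos)
  have hmean_ne_top : p⁻¹ * q ≠ ∞ :=
    ENNReal.mul_ne_top (ENNReal.inv_ne_top.2 hpos) (setLIntegral_finiteMass_ne_top hμ)
  have hcpos : 0 < (p⁻¹ * q).toNNReal := ENNReal.toNNReal_pos hmean_ne_zero hmean_ne_top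
  have hV : IsCadlagModification (finiteMassCond P Z) (conditionedField P Z)
      fun ω => scale (p⁻¹ * q).toNNReal⁻¹ (Y ω) := by
    rw [← hmean]
    exact (hY.mono cond_absolutelyContinuous).div_const _
  have : SFinite (finiteMassCond P Z) := inferInstanceAs (SFinite (_ • P.restrict _))
  rw [bermanRatio, bermanOn_eq_lintegral_excess hV δ x measurableSet_Icc]
  simp only [isHomogeneous_excess δ _ x _ _ (inv_pos.2 hcpos)]
  have hcancel : (p⁻¹ * q)⁻¹ * p⁻¹ = q⁻¹ := by
    rw [ENNReal.mul_inv (Or.inl (ENNReal.inv_ne_zero.2 hptop)) (Or.inl (ENNReal.inv_ne_top.2 hpos)),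
      inv_inv, mul_right_comm, ENNReal.mul_inv_cancel hpos hptop, one_mul]
  rw [lintegral_const_mul' _ _ ENNReal.coe_ne_top, hcond, ENNReal.coe_inv hcpos.ne',
    ENNReal.coe_toNNReal hmean_ne_top, ← mul_assoc, hcancel, mul_div_assoc]

lemma tendsto_bermanRatio_conditionedField_inv_mul [IsFiniteMeasure P]
    (hY : IsCadlagModification P Z Y) (hμ : IsMaxInvariant (P.map Y)) (x : ℝ≥0)
    (hsup : ∫⁻ f, cubeSup (cubeSide δ) 0 f ∂(P.map Y) ≠ ∞)
    (hpos : P.map Y (finiteMass d) ≠ 0) :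
    Tendsto (bermanRatio (finiteMassCond P Z) (conditionedField P Z) δ x) atTop
      (𝓝 ((∫⁻ f in finiteMass d, f.1 0 ∂(P.map Y))⁻¹ * berman P Z δ x)) := by
  have hq : (∫⁻ f in finiteMass d, f.1 0 ∂(P.map Y))⁻¹ ≠ ∞ :=
    ENNReal.inv_ne_top.2 (setLIntegral_finiteMass_ne_zero hμ hpos)
  rw [berman_eq_firstMaxExcess hY hμ x hsup, ← firstMaxExcess_finiteMass hμ x hsup]
  refine (ENNReal.Tendsto.const_mul
    (tendsto_setLIntegral_excess_Icc hμ x hsup (isInvariantSet_finiteMass d _))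
    (Or.inr hq)).congr fun T => ?_
  rw [bermanRatio_conditionedField hY hμ hpos]

theorem berman_conditionedField_eq [IsFiniteMeasure P] (hY : IsCadlagModification P Z Y)
    (hμ : IsMaxInvariant (P.map Y)) (x : ℝ≥0)
    (hsup : ∫⁻ f, cubeSup (cubeSide δ) 0 f ∂(P.map Y) ≠ ∞)
    (hpos : P.map Y (finiteMass d) ≠ 0) :
    berman (finiteMassCond P Z) (conditionedField P Z) δ x =
      (∫⁻ f in finiteMass d, f.1 0 ∂(P.map Y))⁻¹ * berman P Z δ x :=
  (tendsto_bermanRatio_conditionedField_inv_mul hY hμ x hsup hpos).limUnder_eq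

theorem tendsto_bermanRatio_conditionedField [IsFiniteMeasure P]
    (hY : IsCadlagModification P Z Y) (hμ : IsMaxInvariant (P.map Y)) (x : ℝ≥0)
    (hsup : ∫⁻ f, cubeSup (cubeSide δ) 0 f ∂(P.map Y) ≠ ∞)
    (hpos : P.map Y (finiteMass d) ≠ 0) :
    Tendsto (bermanRatio (finiteMassCond P Z) (conditionedField P Z) δ x) atTop
      (𝓝 (berman (finiteMassCond P Z) (conditionedField P Z) δ x)) := by
  rw [berman_conditionedField_eq hY hμ x hsup hpos]
  exact tendsto_bermanRatio_conditionedField_inv_mul hY hμ x hsup hpos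

lemma tiltedLaw_apply_isInvariantSet (μ : Measure (CadlagPath d)) {G : Set (CadlagPath d)}
    (hG : IsInvariantSet h G) : tiltedLaw μ 0 0 G = ∫⁻ f in G, f.1 0 ∂μ := by
  rw [tiltedLaw_apply _ _ _ hG.measurableSet,
    ← lintegral_indicator (measurable_normalize 0 0 hG.measurableSet),
    ← lintegral_indicator hG.measurableSet]
  refine lintegral_congr fun f => ?_
  rcases eq_zero_or_pos (f.1 0) with h0 | hpos
  · simp only [indicator, add_zero, h0, ENNReal.coe_zero, ite_self]
  · refine indicator_eq_indicator ?_ (by rw [add_zero])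
    rw [mem_preimage, normalize, add_zero, shift_zero]
    exact hG.isScaleInvariant _ f (inv_pos.2 hpos)

theorem berman_eq_mul_berman_conditionedField [IsFiniteMeasure P]
    (hY : IsCadlagModification P Z Y) (hμ : IsMaxInvariant (P.map Y)) (x : ℝ≥0)
    (hsup : ∫⁻ f, cubeSup (cubeSide δ) 0 f ∂(P.map Y) ≠ ∞)
    (hY₂ : IsCadlagModification P₂ Θ Y₂) (hlaw : P₂.map Y₂ = tiltedLaw (P.map Y) 0 0)
    (hpos : P.map Y (finiteMass d) ≠ 0) :
    berman P Z δ x = P₂ {ω | totalMass 0 (Θ ω) < ∞} *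
      berman (finiteMassCond P Z) (conditionedField P Z) δ x := by
  rw [← hY₂.map_finiteMass, hlaw, tiltedLaw_apply_isInvariantSet _ (isInvariantSet_finiteMass d 1),
    berman_conditionedField_eq hY hμ x hsup hpos, ← mul_assoc,
    ENNReal.mul_inv_cancel (setLIntegral_finiteMass_ne_zero hμ hpos)
      (setLIntegral_finiteMass_ne_top hμ), one_mul]

end CadlagPath

open CadlagPath

theorem mainTheorem3 {d : ℕ} (hd : 1 ≤ d) {Ω Ω₁ Ω₂ : Type*}
    [MeasurableSpace Ω] [MeasurableSpace Ω₁] [MeasurableSpace Ω₂]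
    (P : Measure Ω) [IsProbabilityMeasure P]
    (P₁ : Measure Ω₁) [IsProbabilityMeasure P₁]
    (P₂ : Measure Ω₂) [IsProbabilityMeasure P₂]
    (Z : Ω → FieldPath d) (hZ : IsSpectralField P Z)
    (E : ℕ → Ω₁ → ℝ) (Zc : ℕ → Ω₁ → FieldPath d) (hX : IsDeHaanInput P Z P₁ E Zc)
    (hstat : IsStationaryField P₁ (deHaanField E Zc))
    (Θ : Ω₂ → FieldPath d) (hΘ : IsTiltedField P Z P₂ Θ)
    (δ x : ℝ≥0) :
    ((∀ᵐ ω ∂P, totalMass 0 (Z ω) < ∞) →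
      Tendsto (bermanRatio P Z δ x) atTop (𝓝 (berman P Z δ x)) ∧
      berman P Z δ x = bermanOn P₂ (normalizedField δ Θ) δ univ x ∧
      berman P Z δ x < ∞) ∧
    (0 < P {ω | totalMass 0 (Z ω) < ∞} →
      Tendsto (bermanRatio P Z δ x) atTop (𝓝 (berman P Z δ x)) ∧
      Tendsto (bermanRatio (finiteMassCond P Z) (conditionedField P Z) δ x) atTop
        (𝓝 (berman (finiteMassCond P Z) (conditionedField P Z) δ x)) ∧
      berman P Z δ x = P₂ {ω | totalMass 0 (Θ ω) < ∞} *
        berman (finiteMassCond P Z) (conditionedField P Z) δ x ∧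
      berman P Z δ x < ∞) := by
  obtain ⟨Y, hY⟩ := exists_isCadlagModification hZ.measurable hZ.cadlag
  obtain ⟨Y₂, hY₂⟩ := exists_isCadlagModification hΘ.measurable hΘ.cadlag
  have hμ : IsMaxInvariant (P.map Y) := isMaxInvariant_map hZ hX hstat hY
  have hsup : ∫⁻ f, cubeSup (cubeSide δ) 0 f ∂(P.map Y) ≠ ∞ :=
    lintegral_cubeSup_ne_top hZ hY (cubeSide_pos δ)
  have hlaw : P₂.map Y₂ = tiltedLaw (P.map Y) 0 0 := map_eq_tiltedLaw hZ.measurable hΘ hY hY₂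
  have hlim := tendsto_bermanRatio hY hμ x hsup
  have hlt := berman_lt_top hY hμ x hsup
  refine ⟨fun hfin => ⟨hlim, ?_, hlt⟩, fun hpos => ?_⟩
  · exact berman_eq_bermanOn_normalizedField hY hμ x hsup hY₂ hlaw hfin
  · rw [← hY.map_finiteMass] at hpos
    exact ⟨hlim, tendsto_bermanRatio_conditionedField hY hμ x hsup hpos.ne',
      berman_eq_mul_berman_conditionedField hY hμ x hsup hY₂ hlaw hpos.ne', hlt⟩
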